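/- Let $(E,\|\cdot\|_E)$ be a real Banach space of Rademacher type $p\in[1,2]$, let $q\in[p,\infty)$, let $k,M\in\mathbb N$ be positive integers, and let $(\Omega,\mathcal A,\mathbb P)$ be a probability space. Let $\eta_1,\dots,\eta_M\in L_{kq}(\Omega;E)$ be independent (not necessarily identically distributed) $E$-valued random variables with vanishing injective $k$th moment, $\mathbb M^k_\varepsilon[\eta_j]=0$ for all $1\le j\le M$. Then $\sum_{j=1}^M\otimes^k\eta_j\in L_q(\Omega;\otimes^{k,s}_{\varepsilon_s}E)$ and $$ \Bigl\|\sum_{j=1}^M \otimes^k\eta_j\Bigr\|_{L_q(\Omega;\,\otimes^{k,s}_{\varepsilon_s}E)} \;\le\; 4k\,K_{q,p}\,\tau_p(E)\,\Bigl(\sum_{j=1}^M\|\eta_j\|_{L_{kq}(\Omega;E)}^{kp}\Bigr)^{1/p}. $$ Here the following notation is used. * For a real Banach space $F$ and $r\in[1,\infty)$, $L_r(\Omega;F)$ is the Bochner space of strongly measurable $\eta:\Omega\to F$ with $\|\eta\|_{L_r(\Omega;F)}=(\mathbb E\|\eta\|_F^r)^{1/r}<\infty$. The dual of $E$ is $E'$,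 with closed unit ball $B_{E'}$, and $\otimes^k x=x\otimes\cdots\otimes x$ ($k$ factors). * $\otimes^k_\varepsilon E$ is the completion of the $k$-fold algebraic tensor power of $E$ with respect to the injective norm $\|U\|_\varepsilon=\sup\{|\langle f_1\otimes\cdots\otimes f_k,U\rangle| : f_1,\dots,f_k\in B_{E'}\}$, and $\mathbb M^k_\varepsilon[\eta]=\mathbb E[\otimes^k\eta]$ is the Bochner integral in $\otimes^k_\varepsilon E$. * $\otimes^{k,s}_{\varepsilon_s}E$ is the completion of the linear span of $\{\otimes^k x: x\in E\}$ with respect to the symmetric injective norm $\bigl\|\sum_j\lambda_j\otimes^k x_j\bigr\|_{\varepsilon_s}=\sup\bigl\{\bigl|\sum_j\lambda_j f(x_j)^k\bigr| : f\in B_{E'}\bigr\}$. * A Rademacher family $(r_j)_{j\in\mathbb N}$ is a family of independent random variables on a complete probability space $(\widetilde\Omega,\widetilde{\mathcal A},\widetilde{\mathbb P})$ with $\widetilde{\mathbb P}(r_j=1)=\widetilde{\mathbb P}(r_j=-1)=\tfrac12$. * $K_{q,p}$, the Kahane–Khintchine constant, is the infimum of all $K\in(0,\infty)$ such that $\bigl\|\sum_{j=1}^n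 r_jx_j\bigr\|_{L_q(\widetilde\Omega;F)}\le K\bigl\|\sum_{j=1}^n r_jx_j\bigr\|_{L_p(\widetilde\Omega;F)}$ for all Rademacher families, all real Banach spaces $F$, all $n\in\mathbb N$ and all $x_1,\dots,x_n\in F$. * $E$ has Rademacher type $p\in[1,2]$ if there is $\tau\in(0,\infty)$ such that $\bigl\|\sum_{j=1}^n r_jx_j\bigr\|_{L_p(\widetilde\Omega;E)}\le\tau\bigl(\sum_{j=1}^n\|x_j\|_E^p\bigr)^{1/p}$ for all Rademacher families, all $n\in\mathbb N$ and all $x_1,\dots,x_n\in E$; the infimum of all such $\tau$ is the type $p$ constant $\tau_p(E)$. -/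

import Mathlib

open MeasureTheory ProbabilityTheory
open scoped TensorProduct ENNReal

universe u v

noncomputable section

namespace InjectiveMoments

/-! ### Rademacher families, Kahane–Khintchine constants, type -/

/-- A Rademacher family indexed by `ℕ` on a complete probability space: independent random
variables with values in `{-1, 1}`, each value being taken with probability `1 / 2`. -/
structure IsRademacherFamily {Ω : Type v} [MeasurableSpace Ω] (P : Measure Ω)
    (r : ℕ → Ω → ℝ) : Prop where
  isProbabilityMeasure : IsProbabilityMeasure P
  isComplete : P.IsComplete
  measurable : ∀ j, Measurable (r j)
  values : ∀ j ω, r j ω = 1 ∨ r j ω = -1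
  prob_one : ∀ j, P {ω | r j ω = 1} = 1 / 2
  prob_neg_one : ∀ j, P {ω | r j ω = -1} = 1 / 2
  indep : iIndepFun r P

/-- `K > 0` is admissible in the `(q, p)` Kahane–Khintchine inequality, for all Rademacher
families, all real Banach spaces `F` and all finite families of vectors of `F`. (Only the joint
law of finitely many signs and the finite-dimensional span of the vectors matter, so the choice of
universes is immaterial.) -/
def IsKahaneKhintchineBound (q p K : ℝ) : Prop :=
  0 < K ∧
  ∀ (Ω : Type) [MeasurableSpace Ω] (P : Measure Ω) (r : ℕ → Ω → ℝ), IsRademacherFamily P r →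
  ∀ (F : Type u) [NormedAddCommGroup F] [NormedSpace ℝ F] [CompleteSpace F]
    (n : ℕ) (x : Fin n → F),
    lpNorm (fun ω => ∑ j : Fin n, r j ω • x j) (ENNReal.ofReal q) P ≤
      K * lpNorm (fun ω => ∑ j : Fin n, r j ω • x j) (ENNReal.ofReal p) P

/-- The Kahane–Khintchine constant `K_{q,p}`. -/
def kahaneKhintchineConst (q p : ℝ) : ℝ := sInf {K : ℝ | IsKahaneKhintchineBound.{u} q p K}

section TypeConst

variable (F : Type u) [NormedAddCommGroup F] [NormedSpace ℝ F]

/-- `τ > 0` is admissible in the Rademacher type `p` inequality of `F`. -/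
def IsTypeBound (p τ : ℝ) : Prop :=
  0 < τ ∧
  ∀ (Ω : Type) [MeasurableSpace Ω] (P : Measure Ω) (r : ℕ → Ω → ℝ), IsRademacherFamily P r →
  ∀ (n : ℕ) (x : Fin n → F),
    lpNorm (fun ω => ∑ j : Fin n, r j ω • x j) (ENNReal.ofReal p) P ≤
      τ * (∑ j : Fin n, ‖x j‖ ^ p) ^ (1 / p)

/-- `F` has Rademacher type `p ∈ [1, 2]`. -/
def HasRademacherType (p : ℝ) : Prop :=
  p ∈ Set.Icc (1 : ℝ) 2 ∧ ∃ τ : ℝ, IsTypeBound F p τ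

/-- The type `p` constant `τ_p(F)`. -/
def typeConst (p : ℝ) : ℝ := sInf {τ : ℝ | IsTypeBound F p τ}

end TypeConst

/-! ### Suprema of pointwise bounded families of functionals are seminorms -/

theorem supCore {V ι : Type*} [AddCommGroup V] [Module ℝ V] [Nonempty ι] [Norm V]
    (φ : ι → V →ₗ[ℝ] ℝ) (hφ : ∀ x, BddAbove (Set.range fun i => |φ i x|))
    (hn : ∀ x : V, ‖x‖ = ⨆ i, |φ i x|) : SeminormedSpace.Core ℝ V where
  norm_nonneg x := by
    rw [hn]
    exact Real.iSup_nonneg fun i => abs_nonneg _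
  norm_smul c x := by
    rw [hn, hn, Real.norm_eq_abs, Real.mul_iSup_of_nonneg (abs_nonneg c)]
    simp [abs_mul]
  norm_triangle x y := by
    rw [hn, hn, hn]
    refine ciSup_le fun i => ?_
    rw [map_add]
    exact (abs_add_le _ _).trans (add_le_add (le_ciSup (hφ x) i) (le_ciSup (hφ y) i))

/-! ### Full and symmetric injective tensor powers -/

variable (k : ℕ) (E : Type u) [NormedAddCommGroup E] [NormedSpace ℝ E]

/-- The algebraic `k`-fold tensor power of `E`, to be equipped with the injective norm. -/
def AlgTensor : Type u := ⨂[ℝ] _ : Fin k, E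

instance : AddCommGroup (AlgTensor k E) := inferInstanceAs (AddCommGroup (⨂[ℝ] _ : Fin k, E))

instance : Module ℝ (AlgTensor k E) := inferInstanceAs (Module ℝ (⨂[ℝ] _ : Fin k, E))

variable {k E}

/-- The pure tensor `x₁ ⊗ ⋯ ⊗ x_k`. -/
def AlgTensor.pure (x : Fin k → E) : AlgTensor k E := PiTensorProduct.tprod ℝ x

/-- The functional `f₁ ⊗ ⋯ ⊗ f_k` on the algebraic tensor power. -/
def AlgTensor.eval (f : Fin k → StrongDual ℝ E) : AlgTensor k E →ₗ[ℝ] ℝ :=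
  PiTensorProduct.lift
    ((MultilinearMap.mkPiAlgebra ℝ (Fin k) ℝ).compLinearMap fun n => (f n).toLinearMap)

theorem AlgTensor.eval_pure (f : Fin k → StrongDual ℝ E) (x : Fin k → E) :
    AlgTensor.eval f (AlgTensor.pure x) = ∏ n, f n (x n) := by
  exact (PiTensorProduct.lift.tprod x).trans (by simp)

variable (k E)

/-- `k`-tuples of functionals in the closed unit ball of the dual of `E`. -/
abbrev DualBallTuple : Type u := Fin k → Metric.closedBall (0 : StrongDual ℝ E) 1

variable {k E}

theorem AlgTensor.bddAbove (U : AlgTensor k E) : ∃ C : ℝ, ∀ f : Fin k → StrongDual ℝ E,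
    (∀ n, ‖f n‖ ≤ 1) → |AlgTensor.eval f U| ≤ C := by
  refine PiTensorProduct.induction_on
    (motive := fun U : AlgTensor k E => ∃ C : ℝ, ∀ f : Fin k → StrongDual ℝ E,
      (∀ n, ‖f n‖ ≤ 1) → |AlgTensor.eval f U| ≤ C) U ?_ ?_
  · intro c x
    refine ⟨|c| * ∏ n, ‖x n‖, fun f hf => ?_⟩
    have h := AlgTensor.eval_pure f x
    have h2 : AlgTensor.eval f (c • AlgTensor.pure x) = c * ∏ n, f n (x n) := by
      rw [map_smul, h, smul_eq_mul]
    refine (congrArg abs h2).le.trans ?_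
    rw [abs_mul, Finset.abs_prod]
    refine mul_le_mul_of_nonneg_left ?_ (abs_nonneg c)
    refine Finset.prod_le_prod (fun _ _ => abs_nonneg _) fun n _ => ?_
    exact ((f n).le_opNorm (x n)).trans (mul_le_of_le_one_left (norm_nonneg _) (hf n))
  · rintro U V ⟨C, hC⟩ ⟨D, hD⟩
    refine ⟨C + D, fun f hf => ?_⟩
    have h : AlgTensor.eval f (U + V) = AlgTensor.eval f U + AlgTensor.eval f V :=
      map_add (AlgTensor.eval f) U V
    exact (congrArg abs h).le.trans
      ((abs_add_le _ _).trans (add_le_add (hC f hf) (hD f hf)))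

/-- The injective norm `‖U‖_ε = sup { |⟨f₁ ⊗ ⋯ ⊗ f_k, U⟩| : f₁, …, f_k ∈ B_{E'} }`. -/
instance : Norm (AlgTensor k E) :=
  ⟨fun U => ⨆ f : DualBallTuple k E, |AlgTensor.eval (fun n => (f n : StrongDual ℝ E)) U|⟩

theorem AlgTensor.core : SeminormedSpace.Core ℝ (AlgTensor k E) := by
  have : Nonempty (DualBallTuple k E) := ⟨fun _ => ⟨0, by simp⟩⟩
  refine supCore (fun f : DualBallTuple k E => AlgTensor.eval fun n => (f n : StrongDual ℝ E))
    (fun U => ?_) (fun U => rfl)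
  obtain ⟨C, hC⟩ := AlgTensor.bddAbove U
  refine ⟨C, ?_⟩
  rintro _ ⟨f, rfl⟩
  exact hC _ fun n => mem_closedBall_zero_iff.mp (f n).2

instance : SeminormedAddCommGroup (AlgTensor k E) :=
  SeminormedAddCommGroup.ofCore AlgTensor.core

instance : NormedSpace ℝ (AlgTensor k E) where
  norm_smul_le c U := (AlgTensor.core.norm_smul c U).le

variable (k E)

/-- The full `k`-fold injective tensor product of `E`: the completion of the algebraic tensor
power with respect to the injective norm. -/
abbrev InjTensor : Type u := UniformSpace.Completion (AlgTensor k E)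

/-- The algebraic symmetric tensor power: the span of the powers `x ⊗ ⋯ ⊗ x`. -/
def symSubmodule : Submodule ℝ (AlgTensor k E) :=
  Submodule.span ℝ (Set.range fun x : E => AlgTensor.pure fun _ : Fin k => x)

/-- The algebraic symmetric tensor power, to be equipped with the symmetric injective norm (and
not with the restriction of the full injective norm). -/
def SymAlgTensor : Type u := symSubmodule k E

instance : AddCommGroup (SymAlgTensor k E) := inferInstanceAs (AddCommGroup (symSubmodule k E))

instance : Module ℝ (SymAlgTensor k E) := inferInstanceAs (Module ℝ (symSubmodule k E))

/-- The inclusion of the symmetric algebraic tensor power in the full one. -/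
def SymAlgTensor.incl : SymAlgTensor k E →ₗ[ℝ] AlgTensor k E := (symSubmodule k E).subtype

variable {k E}

/-- The symmetric injective norm `‖U‖_{ε_s} = sup { |⟨f ⊗ ⋯ ⊗ f, U⟩| : f ∈ B_{E'} }`; for
`U = ∑ j, λ_j • (x_j ⊗ ⋯ ⊗ x_j)` one has `⟨f ⊗ ⋯ ⊗ f, U⟩ = ∑ j, λ_j * f (x_j) ^ k`. -/
instance : Norm (SymAlgTensor k E) :=
  ⟨fun U => ⨆ f : Metric.closedBall (0 : StrongDual ℝ E) 1,
    |AlgTensor.eval (fun _ => (f : StrongDual ℝ E)) (SymAlgTensor.incl k E U)|⟩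

theorem SymAlgTensor.core : SeminormedSpace.Core ℝ (SymAlgTensor k E) := by
  have : Nonempty (Metric.closedBall (0 : StrongDual ℝ E) 1) := ⟨⟨0, by simp⟩⟩
  refine supCore (fun f : Metric.closedBall (0 : StrongDual ℝ E) 1 =>
    (AlgTensor.eval fun _ => (f : StrongDual ℝ E)) ∘ₗ SymAlgTensor.incl k E)
    (fun U => ?_) (fun U => rfl)
  obtain ⟨C, hC⟩ := AlgTensor.bddAbove (SymAlgTensor.incl k E U)
  refine ⟨C, ?_⟩
  rintro _ ⟨f, rfl⟩
  exact hC _ fun n => mem_closedBall_zero_iff.mp f.2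

instance : SeminormedAddCommGroup (SymAlgTensor k E) :=
  SeminormedAddCommGroup.ofCore SymAlgTensor.core

instance : NormedSpace ℝ (SymAlgTensor k E) where
  norm_smul_le c U := (SymAlgTensor.core.norm_smul c U).le

variable (k E)

/-- The `k`-fold symmetric injective tensor product of `E`: the completion of the algebraic
symmetric tensor power with respect to the symmetric injective norm. -/
abbrev SymInjTensor : Type u := UniformSpace.Completion (SymAlgTensor k E)

variable {E}

/-- The power `⊗^k x` as an element of the full injective tensor product. -/
def tensorPow (x : E) : InjTensor k E := ((AlgTensor.pure fun _ => x : AlgTensor k E) : InjTensor k E)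

/-- The power `⊗^k x` as an element of the algebraic symmetric tensor power. -/
def algSymTensorPow (x : E) : SymAlgTensor k E :=
  (⟨AlgTensor.pure fun _ => x, Submodule.subset_span ⟨x, rfl⟩⟩ : symSubmodule k E)

/-- The power `⊗^k x` as an element of the symmetric injective tensor product. -/
def symTensorPow (x : E) : SymInjTensor k E := (algSymTensorPow k x : SymInjTensor k E)

/-- The injective `k`-th moment `𝕄^k_ε[ξ] = 𝔼[⊗^k ξ]`, a Bochner integral in the full injective
tensor product (which exists whenever `ξ ∈ L_k`). -/
def injMoment {Ω : Type v} [MeasurableSpace Ω] (P : Measure Ω) (ξ : Ω → E) : InjTensor k E :=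
  ∫ ω, tensorPow k (ξ ω) ∂P

end InjectiveMoments

end

/-!
For `f` in the dual ball, `f (x) ^ k` is a Lipschitz function of `‖x‖ ^ (k - 1) * f x`, and the
latter is linear in `f`. This reduces the symmetric injective norm to the norm of `E`, as follows.
Symmetrization of the independent centred variables `⊗^k η_j` costs a factor `2`. For fixed `ω`, the
Ledoux–Talagrand contraction principle for suprema over the dual ball replaces `∑ r_j ⊗^k x_j` by
`∑ r_j ‖x_j‖ ^ (k - 1) x_j` at the cost of `2k`, in `L_p` after the Kahane–Khintchine inequality has
lowered the exponent from `q`, and type `p` of `E` bounds this by `(∑ ‖x_j‖ ^ (kp)) ^ (1 / p)`.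
Minkowski's inequality in `L_{q/p}` then moves the norm over `Ω` inside the sum. The
Kahane–Khintchine constant, an infimum, is attained because some constant is admissible; this comes
from iterating a hypercontractive estimate from `L_{2m}` to `L_{4m}`.
-/

namespace InjectiveMoments

open scoped BigOperators

/-! ### Averages over signs -/

/-- The vectors of signs of length `n`, as real vectors; averages `𝔼 ε ∈ signVectors n, g ε` are
the expectations of functions of `n` Rademacher variables. -/
noncomputable def signVectors (n : ℕ) : Finset (Fin n → ℝ) := Fintype.piFinset fun _ => {1, -1}

theorem mem_signVectors {n : ℕ} {ε : Fin n → ℝ} :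
    ε ∈ signVectors n ↔ ∀ j, ε j = 1 ∨ ε j = -1 := by
  simp [signVectors]

theorem signVectors_nonempty (n : ℕ) : (signVectors n).Nonempty :=
  ⟨1, mem_signVectors.mpr fun _ => Or.inl rfl⟩

theorem card_signVectors (n : ℕ) : (signVectors n).card = 2 ^ n := by
  have hcard : ({1, -1} : Finset ℝ).card = 2 := Finset.card_pair (by norm_num)
  simp [signVectors, Fintype.card_piFinset, hcard]

theorem abs_eq_one_of_mem_signVectors {n : ℕ} {ε : Fin n → ℝ} (hε : ε ∈ signVectors n)
    (j : Fin n) : |ε j| = 1 := by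
  rcases mem_signVectors.mp hε j with h | h <;> simp [h]

theorem expect_signVectors_succ {n : ℕ} (g : (Fin (n + 1) → ℝ) → ℝ) :
    𝔼 ε ∈ signVectors (n + 1), g ε =
      𝔼 ε ∈ signVectors n, (g (Fin.cons 1 ε) + g (Fin.cons (-1) ε)) / 2 := by
  have hcons : 𝔼 ε ∈ signVectors (n + 1), g ε =
      𝔼 s ∈ ({1, -1} : Finset ℝ) ×ˢ signVectors n, g (Fin.cons s.1 s.2) :=
    (Finset.expect_equiv (Fin.consEquiv fun _ => ℝ)
      (fun s => by simp [mem_signVectors, Fin.forall_fin_succ]) fun _ _ => rfl).symm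
  rw [hcons, Finset.expect_product, Finset.expect_comm]
  refine Finset.expect_congr rfl fun ε _ => ?_
  rw [Finset.expect_eq_sum_div_card, Finset.sum_pair (by norm_num),
    Finset.card_pair (by norm_num), Nat.cast_two]

theorem expect_signVectors_neg {n : ℕ} (g : (Fin n → ℝ) → ℝ) :
    𝔼 ε ∈ signVectors n, g (-ε) = 𝔼 ε ∈ signVectors n, g ε :=
  Finset.expect_equiv (Equiv.neg _) (fun ε => by
    simp only [mem_signVectors, Equiv.neg_apply, Pi.neg_apply, neg_eq_iff_eq_neg, neg_neg]
    exact forall_congr' fun _ => or_comm) fun _ _ => rfl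

/-! ### The contraction principle -/

theorem convexOn_sub_le_sub {G : ℝ → ℝ} (hG : Monotone G) (hc : ConvexOn ℝ Set.univ G)
    {a b a' b' : ℝ} (hb : b ≤ a) (hbb : b ≤ b') (hd : a - b ≤ a' - b') :
    G a - G b ≤ G a' - G b' := by
  rcases hb.eq_or_lt with rfl | hb
  · have := hG (by linarith : b' ≤ a')
    linarith
  have haa : a ≤ a' := by linarith
  have hb' : b' < a' := by linarith
  have hslope : slope G b a ≤ slope G b' a' := by
    calc slope G b a ≤ slope G b a' :=
          hc.slope_mono (Set.mem_univ b) ⟨Set.mem_univ a, hb.ne'⟩ ⟨Set.mem_univ a', by grind⟩ haa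
      _ = slope G a' b := slope_comm ..
      _ ≤ slope G a' b' :=
          hc.slope_mono (Set.mem_univ a') ⟨Set.mem_univ b, by grind⟩ ⟨Set.mem_univ b', by grind⟩ hbb
      _ = slope G b' a' := slope_comm ..
  have hslope0 : 0 ≤ slope G b a := by
    rw [slope_def_field]
    exact div_nonneg (sub_nonneg.mpr (hG hb.le)) (by linarith)
  calc G a - G b = slope G b a * (a - b) := by
        rw [slope_def_field, div_mul_cancel₀ _ (by linarith)]
    _ ≤ slope G b' a' * (a' - b') :=
        mul_le_mul hslope hd (by linarith) (hslope0.trans hslope)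
    _ = G a' - G b' := by rw [slope_def_field, div_mul_cancel₀ _ (by linarith)]

theorem two_point_contraction {G : ℝ → ℝ} (hG : Monotone G) (hc : ConvexOn ℝ Set.univ G)
    {h h' u u' t t' : ℝ} (hu : |u| ≤ |t|) (hu' : |u'| ≤ |t'|) (huu : |u - u'| ≤ |t - t'|)
    (hplus : h' + u' ≤ h + u) (hminus : h - u ≤ h' - u') :
    G (h + u) + G (h' - u') ≤ max (G (h + t) + G (h' - t')) (G (h' + t') + G (h - t)) := by
  wlog ht : 0 ≤ t generalizing t t'
  · have := this (t := -t) (t' := -t') (by rwa [abs_neg]) (by rwa [abs_neg])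
      (by rwa [neg_sub_neg, abs_sub_comm t'])
      (by linarith)
    simpa only [sub_neg_eq_add, ← sub_eq_add_neg, max_comm, add_comm (G (_ - _))] using this
  rw [abs_le, abs_of_nonneg ht] at hu
  rw [abs_le] at hu'
  rcases le_total t' 0 with ht' | ht'
  · rw [abs_of_nonpos ht'] at hu'
    exact le_max_of_le_left (add_le_add (hG (by linarith)) (hG (by linarith)))
  rw [abs_of_nonneg ht'] at hu'
  rw [abs_le] at huu
  rcases le_total t' t with htt | htt
  · rw [abs_of_nonneg (sub_nonneg.mpr htt)] at huu
    have := convexOn_sub_le_sub hG hc (a := h' - u') (b := h' - t') (a' := h + t)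
      (b' := h + u) (by linarith) (by linarith) (by linarith)
    exact le_max_of_le_left (by linarith)
  · rw [abs_of_nonpos (sub_nonpos.mpr htt)] at huu
    have := convexOn_sub_le_sub hG hc (a := h + u) (b := h - t) (a' := h' + t')
      (b' := h' - u') (by linarith) (by linarith) (by linarith)
    exact le_max_of_le_right (by linarith)

theorem monotone_posPart_rpow {p : ℝ} (hp : 0 ≤ p) : Monotone fun a : ℝ => max a 0 ^ p :=
  fun _ _ hab => Real.rpow_le_rpow (le_max_right _ _) (max_le_max_right 0 hab) hp

theorem continuous_posPart_rpow {p : ℝ} (hp : 0 ≤ p) : Continuous fun a : ℝ => max a 0 ^ p :=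
  (continuous_id.max continuous_const).rpow_const fun _ => Or.inr hp

theorem convexOn_posPart_rpow {p : ℝ} (hp : 1 ≤ p) :
    ConvexOn ℝ Set.univ fun a : ℝ => max a 0 ^ p := by
  refine ⟨convex_univ, fun a _ b _ s t hs ht hst => ?_⟩
  refine (Real.rpow_le_rpow (le_max_right _ _) ?_ (by linarith)).trans
    ((convexOn_rpow hp).2 (le_max_right a 0) (le_max_right b 0) hs ht hst)
  exact ((convexOn_id convex_univ).sup (convexOn_const 0 convex_univ)).2 (Set.mem_univ a)
    (Set.mem_univ b) hs ht hst

section Supremum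

variable {ι : Type*} [Nonempty ι]

theorem iSup_abs_rpow_le {p : ℝ} (hp : 0 ≤ p) {w : ι → ℝ}
    (hw : BddAbove (Set.range fun i => |w i|)) :
    (⨆ i, |w i|) ^ p ≤ max (⨆ i, w i) 0 ^ p + max (⨆ i, -w i) 0 ^ p := by
  obtain ⟨C, hC⟩ := hw
  have hpos : BddAbove (Set.range w) :=
    ⟨C, Set.forall_mem_range.mpr fun i => (le_abs_self _).trans (hC ⟨i, rfl⟩)⟩
  have hneg : BddAbove (Set.range fun i => -w i) :=
    ⟨C, Set.forall_mem_range.mpr fun i => (neg_le_abs _).trans (hC ⟨i, rfl⟩)⟩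
  have hsup : ⨆ i, |w i| ≤ max (max (⨆ i, w i) 0) (max (⨆ i, -w i) 0) := ciSup_le fun i =>
    max_le_max (le_max_of_le_left (le_ciSup hpos i)) (le_max_of_le_left (le_ciSup hneg i))
  refine (Real.rpow_le_rpow (Real.iSup_nonneg fun _ => abs_nonneg _) hsup hp).trans ?_
  rw [(Real.monotoneOn_rpow_Ici_of_exponent_nonneg hp).map_max
    (Set.mem_Ici.mpr (le_max_right _ _)) (Set.mem_Ici.mpr (le_max_right _ _))]
  exact max_le_add_of_nonneg (by positivity) (by positivity)

theorem two_point_iSup_contraction {G : ℝ → ℝ} (hG : Monotone G) (hcont : Continuous G)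
    (hc : ConvexOn ℝ Set.univ G) {h u t : ι → ℝ} {C D : ℝ} (hh : ∀ i, |h i| ≤ C)
    (ht : ∀ i, |t i| ≤ D) (hu : ∀ i, |u i| ≤ |t i|) (huu : ∀ i i', |u i - u i'| ≤ |t i - t i'|) :
    G (⨆ i, (h i + u i)) + G (⨆ i, (h i - u i)) ≤ G (⨆ i, (h i + t i)) + G (⨆ i, (h i - t i)) := by
  have bddAdd {w : ι → ℝ} (hw : ∀ i, |w i| ≤ D) : BddAbove (Set.range fun i => h i + w i) :=
    ⟨C + D, Set.forall_mem_range.mpr fun i =>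
      add_le_add (le_of_abs_le (hh i)) (le_of_abs_le (hw i))⟩
  have bddSub {w : ι → ℝ} (hw : ∀ i, |w i| ≤ D) : BddAbove (Set.range fun i => h i - w i) := by
    simpa only [sub_eq_add_neg] using bddAdd (w := fun i => -w i) fun i => by simpa using hw i
  have huD : ∀ i, |u i| ≤ D := fun i => (hu i).trans (ht i)
  set R := G (⨆ i, (h i + t i)) + G (⨆ i, (h i - t i))
  have hR (i i' : ι) : G (h i + t i) + G (h i' - t i') ≤ R :=
    add_le_add (hG (le_ciSup (bddAdd ht) i)) (hG (le_ciSup (bddSub ht) i'))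
  have hpair {i i' : ι} (hplus : h i' + u i' ≤ h i + u i) (hminus : h i - u i ≤ h i' - u i') :
      G (h i + u i) + G (h i' - u i') ≤ R :=
    (two_point_contraction hG hc (hu i) (hu i') (huu i i') hplus hminus).trans
      (max_le (hR i i') (hR i' i))
  rw [hG.map_ciSup_of_continuousAt hcont.continuousAt (bddAdd huD),
    hG.map_ciSup_of_continuousAt hcont.continuousAt (bddSub huD)]
  refine ciSup_add_ciSup_le fun i i' => ?_
  rcases le_total (h i' + u i') (h i + u i) with hplus | hplus
  · rcases le_total (h i - u i) (h i' - u i') with hminus | hminus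
    · exact hpair hplus hminus
    · have := hpair (le_refl (h i + u i)) le_rfl
      linarith [hG hminus]
  · have := hpair (le_refl (h i' + u i')) le_rfl
    linarith [hG hplus]

theorem expect_iSup_contraction {G : ℝ → ℝ} (hG : Monotone G) (hcont : Continuous G)
    (hc : ConvexOn ℝ Set.univ G) {n : ℕ} {h : ι → ℝ} {u t : Fin n → ι → ℝ} {C D : ℝ}
    (hh : ∀ i, |h i| ≤ C) (ht : ∀ j i, |t j i| ≤ D) (hu : ∀ j i, |u j i| ≤ |t j i|)
    (huu : ∀ j i i', |u j i - u j i'| ≤ |t j i - t j i'|) :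
    𝔼 ε ∈ signVectors n, G (⨆ i, (h i + ∑ j, ε j * u j i)) ≤
      𝔼 ε ∈ signVectors n, G (⨆ i, (h i + ∑ j, ε j * t j i)) := by
  induction n generalizing h C with
  | zero => simp
  | succ n ih =>
    simp only [expect_signVectors_succ, Fin.sum_univ_succ, Fin.cons_zero, Fin.cons_succ, one_mul,
      neg_one_mul, ← add_assoc, ← sub_eq_add_neg]
    calc 𝔼 ε ∈ signVectors n, (G (⨆ i, (h i + u 0 i + ∑ j : Fin n, ε j * u j.succ i)) +
            G (⨆ i, (h i - u 0 i + ∑ j : Fin n, ε j * u j.succ i))) / 2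
        ≤ 𝔼 ε ∈ signVectors n, (G (⨆ i, (h i + t 0 i + ∑ j : Fin n, ε j * u j.succ i)) +
            G (⨆ i, (h i - t 0 i + ∑ j : Fin n, ε j * u j.succ i))) / 2 := by
          refine Finset.expect_le_expect fun ε hε => ?_
          have hbound (i : ι) : |h i + ∑ j : Fin n, ε j * u j.succ i| ≤ C + ∑ _j : Fin n, D := by
            refine (abs_add_le _ _).trans (add_le_add (hh i) ((Finset.abs_sum_le_sum_abs _ _).trans
              (Finset.sum_le_sum fun j _ => ?_)))
            rw [abs_mul, abs_eq_one_of_mem_signVectors hε, one_mul]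
            exact (hu _ i).trans (ht _ i)
          have := two_point_iSup_contraction hG hcont hc hbound (ht 0) (hu 0) (huu 0)
          simp only [add_right_comm _ (∑ _, _), add_sub_right_comm _ (∑ _, _)] at this
          linarith
      _ ≤ 𝔼 ε ∈ signVectors n, (G (⨆ i, (h i + t 0 i + ∑ j : Fin n, ε j * t j.succ i)) +
            G (⨆ i, (h i - t 0 i + ∑ j : Fin n, ε j * t j.succ i))) / 2 := by
          simp only [← Finset.expect_div, Finset.expect_add_distrib]
          refine div_le_div_of_nonneg_right (add_le_add ?_ ?_) zero_le_two
          · exact ih (C := C + D) (fun i => (abs_add_le _ _).trans (add_le_add (hh i) (ht 0 i)))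
              (fun j => ht j.succ) (fun j => hu j.succ) fun j => huu j.succ
          · exact ih (C := C + D) (fun i => (abs_sub _ _).trans (add_le_add (hh i) (ht 0 i)))
              (fun j => ht j.succ) (fun j => hu j.succ) fun j => huu j.succ

theorem expect_iSup_abs_rpow_contraction {p : ℝ} (hp : 1 ≤ p) {n : ℕ} {u t : Fin n → ι → ℝ} {D : ℝ}
    (ht : ∀ j i, |t j i| ≤ D) (hu : ∀ j i, |u j i| ≤ |t j i|)
    (huu : ∀ j i i', |u j i - u j i'| ≤ |t j i - t j i'|) :
    𝔼 ε ∈ signVectors n, (⨆ i, |∑ j, ε j * u j i|) ^ p ≤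
      2 * 𝔼 ε ∈ signVectors n, (⨆ i, |∑ j, ε j * t j i|) ^ p := by
  set G : ℝ → ℝ := fun a => max a 0 ^ p
  have bdd {w : Fin n → ι → ℝ} (hw : ∀ j i, |w j i| ≤ D) (ε : Fin n → ℝ) :
      BddAbove (Set.range fun i => |∑ j, ε j * w j i|) := by
    refine ⟨∑ j, |ε j| * D, Set.forall_mem_range.mpr fun i => ?_⟩
    refine (Finset.abs_sum_le_sum_abs _ _).trans (Finset.sum_le_sum fun j _ => ?_)
    rw [abs_mul]
    gcongr
    exact hw j i
  have hcontr : 𝔼 ε ∈ signVectors n, G (⨆ i, ∑ j, ε j * u j i) ≤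
      𝔼 ε ∈ signVectors n, G (⨆ i, ∑ j, ε j * t j i) := by
    simpa only [zero_add] using expect_iSup_contraction (monotone_posPart_rpow (by linarith))
      (continuous_posPart_rpow (by linarith)) (convexOn_posPart_rpow hp) (h := fun _ : ι => 0)
      (fun _ => abs_zero.le) ht hu huu
  have hsplit (ε : Fin n → ℝ) : (⨆ i, |∑ j, ε j * u j i|) ^ p ≤
      G (⨆ i, ∑ j, ε j * u j i) + G (⨆ i, ∑ j, (-ε) j * u j i) := by
    simp only [Pi.neg_apply, neg_mul, Finset.sum_neg_distrib]
    exact iSup_abs_rpow_le (by linarith) (bdd (fun j i => (hu j i).trans (ht j i)) ε)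
  calc 𝔼 ε ∈ signVectors n, (⨆ i, |∑ j, ε j * u j i|) ^ p
      ≤ 𝔼 ε ∈ signVectors n, (G (⨆ i, ∑ j, ε j * u j i) + G (⨆ i, ∑ j, (-ε) j * u j i)) :=
        Finset.expect_le_expect fun ε _ => hsplit ε
    _ = 2 * 𝔼 ε ∈ signVectors n, G (⨆ i, ∑ j, ε j * u j i) := by
        rw [Finset.expect_add_distrib,
          expect_signVectors_neg fun ε => G (⨆ i, ∑ j, ε j * u j i), two_mul]
    _ ≤ 2 * 𝔼 ε ∈ signVectors n, (⨆ i, |∑ j, ε j * t j i|) ^ p := by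
        refine mul_le_mul_of_nonneg_left ?_ zero_le_two
        refine hcontr.trans (Finset.expect_le_expect fun ε _ => ?_)
        have hsup : 0 ≤ ⨆ i, |∑ j, ε j * t j i| := Real.iSup_nonneg fun _ => abs_nonneg _
        refine Real.rpow_le_rpow (le_max_right _ _)
          (max_le (ciSup_mono (bdd ht ε) fun i => le_abs_self _) hsup) (by linarith)

end Supremum

/-! ### Kahane's inequality -/

theorem expect_add_sq_le {κ : Type*} {s : Finset κ} {g h : κ → ℝ} {a b : ℝ} (ha : 0 ≤ a)
    (hb : 0 ≤ b) (hg : 𝔼 i ∈ s, g i ^ 2 ≤ a ^ 2) (hh : 𝔼 i ∈ s, h i ^ 2 ≤ b ^ 2) :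
    𝔼 i ∈ s, (g i + h i) ^ 2 ≤ (a + b) ^ 2 := by
  have hgh : 𝔼 i ∈ s, g i * h i ≤ a * b := by
    refine abs_le_of_sq_le_sq' ?_ (mul_nonneg ha hb) |>.2
    calc (𝔼 i ∈ s, g i * h i) ^ 2 ≤ (𝔼 i ∈ s, g i ^ 2) * 𝔼 i ∈ s, h i ^ 2 :=
          Finset.expect_mul_sq_le_sq_mul_sq s g h
      _ ≤ a ^ 2 * b ^ 2 :=
          mul_le_mul hg hh (Finset.expect_nonneg fun i _ => sq_nonneg _) (sq_nonneg a)
      _ = (a * b) ^ 2 := (mul_pow a b 2).symm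
  calc 𝔼 i ∈ s, (g i + h i) ^ 2
      = 𝔼 i ∈ s, g i ^ 2 + 2 * 𝔼 i ∈ s, g i * h i + 𝔼 i ∈ s, h i ^ 2 := by
        simp only [add_sq, Finset.expect_add_distrib, Finset.mul_expect, mul_assoc]
    _ ≤ (a + b) ^ 2 := by linarith [add_sq a b]

theorem expect_sq_pow_three_le {κ : Type*} {s : Finset κ} {g : κ → ℝ} (hg : ∀ i, 0 ≤ g i) :
    (𝔼 i ∈ s, g i ^ 2) ^ 3 ≤ (𝔼 i ∈ s, g i) ^ 2 * 𝔼 i ∈ s, (g i ^ 2) ^ 2 := by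
  set m₁ := 𝔼 i ∈ s, g i
  set m₂ := 𝔼 i ∈ s, g i ^ 2
  set m₃ := 𝔼 i ∈ s, g i ^ 3
  set m₄ := 𝔼 i ∈ s, (g i ^ 2) ^ 2
  have hm₂0 : 0 ≤ m₂ := Finset.expect_nonneg fun i _ => sq_nonneg _
  have hm₄0 : 0 ≤ m₄ := Finset.expect_nonneg fun i _ => sq_nonneg _
  have hcube (i : κ) : g i * g i ^ 2 = g i ^ 3 := (pow_succ' (g i) 2).symm
  have h₂ : m₂ ^ 2 ≤ m₁ * m₃ := by
    have hsqrt (i : κ) : √(g i) ^ 2 = g i := Real.sq_sqrt (hg i)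
    have hcs := Finset.expect_mul_sq_le_sq_mul_sq s (fun i => √(g i)) fun i => √(g i) * g i
    simpa only [mul_pow, ← mul_assoc, ← sq, hsqrt, hcube] using hcs
  have h₃ : m₃ ^ 2 ≤ m₂ * m₄ := by
    have hcs := Finset.expect_mul_sq_le_sq_mul_sq s g fun i => g i ^ 2
    rwa [Finset.expect_congr rfl fun i _ => hcube i] at hcs
  rcases hm₂0.eq_or_lt with hzero | hpos
  · rw [← hzero, zero_pow three_ne_zero]
    exact mul_nonneg (sq_nonneg _) hm₄0
  refine le_of_mul_le_mul_left ?_ hpos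
  calc m₂ * m₂ ^ 3 = (m₂ ^ 2) ^ 2 := by ring
    _ ≤ (m₁ * m₃) ^ 2 := by gcongr
    _ = m₁ ^ 2 * m₃ ^ 2 := by ring
    _ ≤ m₁ ^ 2 * (m₂ * m₄) := by gcongr
    _ = m₂ * (m₁ ^ 2 * m₄) := by ring

section Kahane

variable {F : Type*} [NormedAddCommGroup F] [NormedSpace ℝ F]

theorem norm_add_half_smul_pow_le (v x : F) (m : ℕ) :
    ‖v + (1 / 2 : ℝ) • x‖ ^ m ≤ (3 * ‖v + x‖ ^ m + ‖v - x‖ ^ m) / 4 := by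
  have hnorm : ‖v + (1 / 2 : ℝ) • x‖ ≤ (3 / 4) * ‖v + x‖ + (1 / 4) * ‖v - x‖ := by
    have hconv : v + (1 / 2 : ℝ) • x = (3 / 4 : ℝ) • (v + x) + (1 / 4 : ℝ) • (v - x) := by module
    rw [hconv]
    refine (norm_add_le _ _).trans_eq ?_
    rw [norm_smul, norm_smul]
    norm_num
  have hpow := (convexOn_pow m).2 (norm_nonneg (v + x)) (norm_nonneg (v - x))
    (by norm_num : (0 : ℝ) ≤ 3 / 4) (by norm_num : (0 : ℝ) ≤ 1 / 4) (by norm_num)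
  simp only [smul_eq_mul] at hpow
  linarith [pow_le_pow_left₀ (norm_nonneg _) hnorm m]

theorem norm_two_point_hypercontractive (v x : F) (m : ℕ) :
    ((‖v + (1 / 2 : ℝ) • x‖ ^ (2 * m)) ^ 2 + (‖v - (1 / 2 : ℝ) • x‖ ^ (2 * m)) ^ 2) / 2 ≤
      ((‖v + x‖ ^ (2 * m) + ‖v - x‖ ^ (2 * m)) / 2) ^ 2 := by
  have hplus := norm_add_half_smul_pow_le v x m
  have hminus := norm_add_half_smul_pow_le v (-x) m
  rw [smul_neg, ← sub_eq_add_neg, ← sub_eq_add_neg, sub_neg_eq_add] at hminus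
  set A := ‖v + x‖ ^ m
  set B := ‖v - x‖ ^ m
  simp only [mul_comm 2 m, pow_mul]
  calc (((‖v + (1 / 2 : ℝ) • x‖ ^ m) ^ 2) ^ 2 + ((‖v - (1 / 2 : ℝ) • x‖ ^ m) ^ 2) ^ 2) / 2
      ≤ ((((3 * A + B) / 4) ^ 2) ^ 2 + (((3 * B + A) / 4) ^ 2) ^ 2) / 2 := by gcongr
    _ ≤ ((A ^ 2 + B ^ 2) / 2) ^ 2 := by
        nlinarith [sq_nonneg (A ^ 2 - B ^ 2), sq_nonneg ((A - B) ^ 2)]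

theorem expect_norm_hypercontractive {n : ℕ} (v : F) (x : Fin n → F) (m : ℕ) :
    𝔼 ε ∈ signVectors n, (‖v + (1 / 2 : ℝ) • ∑ j, ε j • x j‖ ^ (2 * m)) ^ 2 ≤
      (𝔼 ε ∈ signVectors n, ‖v + ∑ j, ε j • x j‖ ^ (2 * m)) ^ 2 := by
  induction n generalizing v with
  | zero => simp [signVectors]
  | succ n ih =>
    simp only [expect_signVectors_succ, Fin.sum_univ_succ, Fin.cons_zero, Fin.cons_succ, one_smul,
      neg_smul, smul_add, smul_neg, ← add_assoc, ← sub_eq_add_neg]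
    set S : (Fin n → ℝ) → F := fun ε => ∑ j, ε j • x j.succ
    have hstep (w : F) : 𝔼 ε ∈ signVectors n, (‖w + (1 / 2 : ℝ) • S ε‖ ^ (2 * m) / 2) ^ 2 ≤
        (𝔼 ε ∈ signVectors n, ‖w + S ε‖ ^ (2 * m) / 2) ^ 2 := by
      simp only [div_pow, ← Finset.expect_div]
      exact div_le_div_of_nonneg_right (ih w fun j => x j.succ) (by norm_num)
    have hnonneg (w : F) : 0 ≤ 𝔼 ε ∈ signVectors n, ‖w + S ε‖ ^ (2 * m) / 2 :=
      Finset.expect_nonneg fun _ _ => by positivity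
    calc 𝔼 ε ∈ signVectors n, ((‖v + (1 / 2 : ℝ) • x 0 + (1 / 2 : ℝ) • S ε‖ ^ (2 * m)) ^ 2 +
            (‖v - (1 / 2 : ℝ) • x 0 + (1 / 2 : ℝ) • S ε‖ ^ (2 * m)) ^ 2) / 2
        ≤ 𝔼 ε ∈ signVectors n, (‖v + x 0 + (1 / 2 : ℝ) • S ε‖ ^ (2 * m) / 2 +
            ‖v - x 0 + (1 / 2 : ℝ) • S ε‖ ^ (2 * m) / 2) ^ 2 := by
          refine Finset.expect_le_expect fun ε _ => ?_
          have := norm_two_point_hypercontractive (v + (1 / 2 : ℝ) • S ε) (x 0) m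
          simpa only [← add_div, add_right_comm v, add_sub_right_comm v] using this
      _ ≤ (𝔼 ε ∈ signVectors n, ‖v + x 0 + S ε‖ ^ (2 * m) / 2 +
            𝔼 ε ∈ signVectors n, ‖v - x 0 + S ε‖ ^ (2 * m) / 2) ^ 2 :=
          expect_add_sq_le (hnonneg _) (hnonneg _) (hstep _) (hstep _)
      _ = (𝔼 ε ∈ signVectors n,
            (‖v + x 0 + S ε‖ ^ (2 * m) + ‖v - x 0 + S ε‖ ^ (2 * m)) / 2) ^ 2 := by
          simp only [← Finset.expect_add_distrib, add_div]

theorem expect_norm_pow_doubling {n : ℕ} (x : Fin n → F) (m : ℕ) :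
    𝔼 ε ∈ signVectors n, (‖∑ j, ε j • x j‖ ^ (2 * m)) ^ 2 ≤
      (4 ^ m * 𝔼 ε ∈ signVectors n, ‖∑ j, ε j • x j‖ ^ (2 * m)) ^ 2 := by
  have h := expect_norm_hypercontractive 0 x m
  simp only [zero_add, norm_smul, mul_pow, ← Finset.mul_expect] at h
  have hhalf : (4 ^ m : ℝ) * ‖(1 / 2 : ℝ)‖ ^ (2 * m) = 1 := by
    rw [pow_mul, ← mul_pow]
    norm_num
  calc 𝔼 ε ∈ signVectors n, (‖∑ j, ε j • x j‖ ^ (2 * m)) ^ 2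
      = (4 ^ m) ^ 2 * ((‖(1 / 2 : ℝ)‖ ^ (2 * m)) ^ 2 *
          𝔼 ε ∈ signVectors n, (‖∑ j, ε j • x j‖ ^ (2 * m)) ^ 2) := by
        rw [← mul_assoc, ← mul_pow, hhalf, one_pow, one_mul]
    _ ≤ (4 ^ m * 𝔼 ε ∈ signVectors n, ‖∑ j, ε j • x j‖ ^ (2 * m)) ^ 2 := by
        rw [mul_pow]
        gcongr

theorem expect_norm_sq_le {n : ℕ} (x : Fin n → F) :
    𝔼 ε ∈ signVectors n, ‖∑ j, ε j • x j‖ ^ 2 ≤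
      (4 * 𝔼 ε ∈ signVectors n, ‖∑ j, ε j • x j‖) ^ 2 := by
  have hholder := expect_sq_pow_three_le (s := signVectors n)
    fun ε : Fin n → ℝ => norm_nonneg (∑ j, ε j • x j)
  have hdouble := expect_norm_pow_doubling x 1
  rw [mul_one, pow_one] at hdouble
  set m₁ := 𝔼 ε ∈ signVectors n, ‖∑ j, ε j • x j‖
  set m₂ := 𝔼 ε ∈ signVectors n, ‖∑ j, ε j • x j‖ ^ 2
  have hm₂ : 0 ≤ m₂ := Finset.expect_nonneg fun _ _ => by positivity
  rcases hm₂.eq_or_lt with hzero | hpos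
  · rw [← hzero]
    positivity
  refine le_of_mul_le_mul_left ?_ (pow_pos hpos 2)
  calc m₂ ^ 2 * m₂ = m₂ ^ 3 := by ring
    _ ≤ m₁ ^ 2 * (4 * m₂) ^ 2 := hholder.trans (by gcongr)
    _ = m₂ ^ 2 * (4 * m₁) ^ 2 := by ring

theorem expect_norm_two_pow_le {n : ℕ} (x : Fin n → F) (i : ℕ) :
    𝔼 ε ∈ signVectors n, ‖∑ j, ε j • x j‖ ^ 2 ^ i ≤
      (4 ^ i * 𝔼 ε ∈ signVectors n, ‖∑ j, ε j • x j‖) ^ 2 ^ i := by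
  induction i with
  | zero => simp
  | succ i ih =>
    rcases i.eq_zero_or_pos with rfl | hi
    · simpa using expect_norm_sq_le x
    obtain ⟨m, hm⟩ : ∃ m, 2 ^ i = 2 * m := dvd_pow_self 2 hi.ne'
    have hdouble := expect_norm_pow_doubling x m
    rw [← hm] at hdouble
    simp only [pow_succ 2 i, pow_mul]
    refine hdouble.trans (pow_le_pow_left₀ ?_ ?_ 2)
    · exact mul_nonneg (by positivity) (Finset.expect_nonneg fun _ _ => by positivity)
    set m₁ := 𝔼 ε ∈ signVectors n, ‖∑ j, ε j • x j‖
    calc 4 ^ m * 𝔼 ε ∈ signVectors n, ‖∑ j, ε j • x j‖ ^ 2 ^ i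
        ≤ 4 ^ 2 ^ i * (4 ^ i * m₁) ^ 2 ^ i := by
          gcongr
          · norm_num
          · omega
      _ = (4 ^ (i + 1) * m₁) ^ 2 ^ i := by rw [← mul_pow, pow_succ' 4 i, mul_assoc]

end Kahane

/-! ### Norms in `L_p` -/

section LpNorm

variable {α G : Type*} [MeasurableSpace α] [NormedAddCommGroup G] {μ : Measure α} {f g : α → G}

theorem lpNorm_congr_ae (h : f =ᵐ[μ] g) (s : ℝ≥0∞) : lpNorm f s μ = lpNorm g s μ := by
  rw [lpNorm, lpNorm, eLpNorm_congr_ae h]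
  classical exact if_congr (aestronglyMeasurable_congr h) rfl rfl

theorem lpNorm_mono_exponent [IsProbabilityMeasure μ] {s t : ℝ≥0∞} (hst : s ≤ t)
    (hf : MemLp f t μ) : lpNorm f s μ ≤ lpNorm f t μ := by
  rw [← toReal_eLpNorm hf.1, ← toReal_eLpNorm hf.1]
  exact ENNReal.toReal_mono hf.eLpNorm_ne_top (eLpNorm_le_eLpNorm_of_exponent_le hst hf.1)

theorem lpNorm_ofReal_rpow {s : ℝ} (hs : 0 < s) (hf : AEStronglyMeasurable f μ) :
    lpNorm f (ENNReal.ofReal s) μ ^ s = ∫ a, ‖f a‖ ^ s ∂μ := by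
  rw [lpNorm_eq_integral_norm_rpow_toReal (by simpa using hs) ENNReal.ofReal_ne_top hf,
    ENNReal.toReal_ofReal hs.le,
    Real.rpow_inv_rpow (integral_nonneg fun _ => by positivity) hs.ne']

theorem memLp_norm_rpow {r s : ℝ} (hr : 0 < r) (hf : MemLp f (ENNReal.ofReal (r * s)) μ) :
    MemLp (fun a => ‖f a‖ ^ r) (ENNReal.ofReal s) μ := by
  have h := hf.norm_rpow_div (ENNReal.ofReal r)
  rwa [ENNReal.toReal_ofReal hr.le, ← ENNReal.ofReal_div_of_pos hr,
    mul_div_cancel_left₀ _ hr.ne'] at h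

theorem memLp_norm_pow {k : ℕ} (hk : k ≠ 0) {s : ℝ} (hf : MemLp f (ENNReal.ofReal (k * s)) μ) :
    MemLp (fun a => ‖f a‖ ^ k) (ENNReal.ofReal s) μ := by
  simpa only [Real.rpow_natCast] using memLp_norm_rpow (by positivity) hf

theorem lpNorm_norm_rpow {r s : ℝ} (hr : 0 < r) (hf : AEStronglyMeasurable f μ) :
    lpNorm (fun a => ‖f a‖ ^ r) (ENNReal.ofReal s) μ = lpNorm f (ENNReal.ofReal (r * s)) μ ^ r := by
  have hpow : AEStronglyMeasurable (fun a => ‖f a‖ ^ r) μ :=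
    (Real.continuous_rpow_const hr.le).comp_aestronglyMeasurable hf.norm
  rw [← toReal_eLpNorm hpow, ← toReal_eLpNorm hf, eLpNorm_norm_rpow f hr,
    ← ENNReal.toReal_rpow, mul_comm r, ENNReal.ofReal_mul' hr.le]

theorem lpNorm_norm_pow {k : ℕ} (hk : k ≠ 0) {s : ℝ} (hf : AEStronglyMeasurable f μ) :
    lpNorm (fun a => ‖f a‖ ^ k) (ENNReal.ofReal s) μ = lpNorm f (ENNReal.ofReal (k * s)) μ ^ k := by
  simpa only [Real.rpow_natCast] using lpNorm_norm_rpow (r := k) (by positivity) hf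

/- Minkowski's inequality in `L_{q/p}` for the functions `‖f j‖ ^ p`. -/
theorem lpNorm_rpow_sum_rpow_le {ι : Type*} (S : Finset ι) {p q : ℝ} (hp : 0 < p) (hpq : p ≤ q)
    {f : ι → α → G} (hf : ∀ j ∈ S, MemLp (f j) (ENNReal.ofReal q) μ) :
    MemLp (fun a => (∑ j ∈ S, ‖f j a‖ ^ p) ^ (1 / p)) (ENNReal.ofReal q) μ ∧
      lpNorm (fun a => (∑ j ∈ S, ‖f j a‖ ^ p) ^ (1 / p)) (ENNReal.ofReal q) μ ≤
        (∑ j ∈ S, lpNorm (f j) (ENNReal.ofReal q) μ ^ p) ^ (1 / p) := by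
  have hexp : p * (q / p) = q := mul_div_cancel₀ q hp.ne'
  have hexp' : 1 / p * q = q / p := by ring
  have hpow (j : ι) (hj : j ∈ S) : MemLp (fun a => ‖f j a‖ ^ p) (ENNReal.ofReal (q / p)) μ :=
    memLp_norm_rpow hp (by rw [hexp]; exact hf j hj)
  have hsum : MemLp (fun a => ∑ j ∈ S, ‖f j a‖ ^ p) (ENNReal.ofReal (q / p)) μ :=
    memLp_finsetSum _ hpow
  have hnorm (a : α) : ‖∑ j ∈ S, ‖f j a‖ ^ p‖ = ∑ j ∈ S, ‖f j a‖ ^ p :=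
    Real.norm_of_nonneg (by positivity)
  constructor
  · rw [← hexp'] at hsum
    simpa only [hnorm] using memLp_norm_rpow (one_div_pos.mpr hp) hsum
  · have hroot := lpNorm_norm_rpow (s := q) (one_div_pos.mpr hp) hsum.1
    simp only [hnorm, hexp'] at hroot
    rw [hroot]
    refine Real.rpow_le_rpow lpNorm_nonneg ?_ (by positivity)
    calc lpNorm (fun a => ∑ j ∈ S, ‖f j a‖ ^ p) (ENNReal.ofReal (q / p)) μ
        ≤ ∑ j ∈ S, lpNorm (fun a => ‖f j a‖ ^ p) (ENNReal.ofReal (q / p)) μ := by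
          simpa only [Finset.sum_fn] using lpNorm_sum_le hpow
            (by simpa using (one_le_div hp).mpr hpq)
      _ = ∑ j ∈ S, lpNorm (f j) (ENNReal.ofReal q) μ ^ p :=
          Finset.sum_congr rfl fun j hj => by rw [lpNorm_norm_rpow hp (hf j hj).1, hexp]

end LpNorm

/-! ### Rademacher families -/

/-- The norm of the Rademacher sum `∑ j, r_j x_j` in `L_p`, written as a finite average over sign
vectors so that it does not refer to a sample space. -/
noncomputable def rademacherNorm {F : Type*} [NormedAddCommGroup F] [NormedSpace ℝ F] (p : ℝ)
    {n : ℕ} (x : Fin n → F) : ℝ :=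
  (𝔼 ε ∈ signVectors n, ‖∑ j, ε j • x j‖ ^ p) ^ (1 / p)

theorem rademacherNorm_nonneg {F : Type*} [NormedAddCommGroup F] [NormedSpace ℝ F] (p : ℝ)
    {n : ℕ} (x : Fin n → F) : 0 ≤ rademacherNorm p x :=
  Real.rpow_nonneg (Finset.expect_nonneg fun _ _ => by positivity) _

theorem le_sInf_mul {s : Set ℝ} (hs : s.Nonempty) {a b : ℝ} (hb : 0 ≤ b)
    (h : ∀ c ∈ s, a ≤ c * b) : a ≤ sInf s * b := by
  rcases hb.eq_or_lt with rfl | hb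
  · simpa using h _ hs.some_mem
  · exact (div_le_iff₀ hb).mp (le_csInf hs fun c hc => (div_le_iff₀ hb).mpr (h c hc))

section RademacherFamily

variable {Ω : Type v} [MeasurableSpace Ω] {P : Measure Ω} {r : ℕ → Ω → ℝ}

namespace IsRademacherFamily

theorem mem_signVectors (hr : IsRademacherFamily P r) (n : ℕ) (ω : Ω) :
    (fun j : Fin n => r j ω) ∈ signVectors n :=
  InjectiveMoments.mem_signVectors.mpr fun j => hr.values j ω

theorem map_real_singleton (hr : IsRademacherFamily P r) {n : ℕ} {ε : Fin n → ℝ}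
    (hε : ε ∈ signVectors n) : (P.map fun ω (j : Fin n) => r j ω).real {ε} = 1 / 2 ^ n := by
  have := hr.isProbabilityMeasure
  have hindep : iIndepFun (fun j : Fin n => r j) P := hr.indep.precomp Fin.val_injective
  have hcoord (j : Fin n) : P.map (r j) {ε j} = 1 / 2 := by
    rw [Measure.map_apply (hr.measurable j) (measurableSet_singleton _)]
    rcases InjectiveMoments.mem_signVectors.mp hε j with h | h <;> rw [h]
    exacts [hr.prob_one j, hr.prob_neg_one j]
  rw [measureReal_def, iIndepFun.map_fun_eq_pi_map (f := fun j : Fin n => r j)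
    (fun j => (hr.measurable j).aemeasurable) hindep, Measure.pi_singleton,
    Finset.prod_congr rfl fun j _ => hcoord j]
  simp

theorem integral_comp_eq_expect (hr : IsRademacherFamily P r) {n : ℕ} {g : (Fin n → ℝ) → ℝ}
    (hg : Continuous g) : ∫ ω, g (fun j => r j ω) ∂P = 𝔼 ε ∈ signVectors n, g ε := by
  have := hr.isProbabilityMeasure
  have hX : Measurable fun ω (j : Fin n) => r j ω := measurable_pi_lambda _ fun j => hr.measurable j
  have hmem : ∀ᵐ ε ∂P.map (fun ω (j : Fin n) => r j ω), ε ∈ (signVectors n : Set (Fin n → ℝ)) :=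
    (ae_map_iff hX.aemeasurable (Finset.measurableSet _)).mpr
      (Filter.Eventually.of_forall fun ω => hr.mem_signVectors n ω)
  rw [← integral_map hX.aemeasurable hg.aestronglyMeasurable,
    ← Measure.restrict_eq_self_of_ae_mem hmem, setIntegral_finset _ .finset,
    Finset.expect_eq_sum_div_card, card_signVectors,
    Finset.sum_div]
  refine Finset.sum_congr rfl fun ε hε => ?_
  rw [hr.map_real_singleton hε, smul_eq_mul]
  push_cast
  ring

variable {F : Type*} [NormedAddCommGroup F] [NormedSpace ℝ F]

theorem memLp_sum (hr : IsRademacherFamily P r) {n : ℕ} (x : Fin n → F) (s : ℝ≥0∞) :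
    MemLp (fun ω => ∑ j : Fin n, r j ω • x j) s P := by
  have := hr.isProbabilityMeasure
  refine memLp_finsetSum _ fun j _ => MemLp.of_bound
    ((hr.measurable j).stronglyMeasurable.smul_const _).aestronglyMeasurable ‖x j‖
    (Filter.Eventually.of_forall fun ω => ?_)
  rcases hr.values j ω with h | h <;> simp [h]

theorem lpNorm_sum (hr : IsRademacherFamily P r) {n : ℕ} (x : Fin n → F) {s : ℝ} (hs : 0 < s) :
    lpNorm (fun ω => ∑ j : Fin n, r j ω • x j) (ENNReal.ofReal s) P = rademacherNorm s x := by
  have hcont : Continuous fun ε : Fin n → ℝ => ‖∑ j, ε j • x j‖ ^ s :=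
    Continuous.rpow_const (by fun_prop) fun _ => Or.inr hs.le
  rw [lpNorm_eq_integral_norm_rpow_toReal (by simpa using hs) ENNReal.ofReal_ne_top
    (hr.memLp_sum x 1).1, ENNReal.toReal_ofReal hs.le, hr.integral_comp_eq_expect hcont,
    rademacherNorm, one_div]

end IsRademacherFamily

theorem rademacherNorm_two_pow_le {F : Type*} [NormedAddCommGroup F] [NormedSpace ℝ F] {n : ℕ}
    (x : Fin n → F) (i : ℕ) : rademacherNorm (2 ^ i) x ≤ 4 ^ i * rademacherNorm 1 x := by
  have h := expect_norm_two_pow_le x i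
  have hpow : rademacherNorm (2 ^ i) x =
      (𝔼 ε ∈ signVectors n, ‖∑ j, ε j • x j‖ ^ 2 ^ i) ^ (((2 ^ i : ℕ) : ℝ)⁻¹) := by
    simp only [rademacherNorm, one_div, ← Real.rpow_natCast, Nat.cast_pow, Nat.cast_ofNat]
  have h1 : rademacherNorm 1 x = 𝔼 ε ∈ signVectors n, ‖∑ j, ε j • x j‖ := by
    simp [rademacherNorm]
  rw [hpow, h1]
  refine (Real.rpow_le_rpow (Finset.expect_nonneg fun _ _ => by positivity) h
    (by positivity)).trans_eq ?_
  refine Real.pow_rpow_inv_natCast (mul_nonneg (by positivity)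
    (Finset.expect_nonneg fun _ _ => norm_nonneg _)) (by positivity)

theorem exists_isKahaneKhintchineBound (q : ℝ) {p : ℝ} (hp : 1 ≤ p) :
    ∃ K, IsKahaneKhintchineBound.{u} q p K := by
  obtain ⟨i, hi⟩ := pow_unbounded_of_one_lt q one_lt_two
  refine ⟨4 ^ i, by positivity, fun Ω _ P r hr F _ _ _ n x => ?_⟩
  have := hr.isProbabilityMeasure
  calc lpNorm (fun ω => ∑ j : Fin n, r j ω • x j) (ENNReal.ofReal q) P
      ≤ lpNorm (fun ω => ∑ j : Fin n, r j ω • x j) (ENNReal.ofReal (2 ^ i)) P :=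
        lpNorm_mono_exponent (ENNReal.ofReal_le_ofReal hi.le) (hr.memLp_sum x _)
    _ ≤ 4 ^ i * lpNorm (fun ω => ∑ j : Fin n, r j ω • x j) (ENNReal.ofReal 1) P := by
        rw [hr.lpNorm_sum x (by positivity), hr.lpNorm_sum x one_pos]
        exact rademacherNorm_two_pow_le x i
    _ ≤ 4 ^ i * lpNorm (fun ω => ∑ j : Fin n, r j ω • x j) (ENNReal.ofReal p) P := by
        gcongr
        exact lpNorm_mono_exponent (ENNReal.ofReal_le_ofReal hp) (hr.memLp_sum x _)

theorem iIndepFun_completion {α ι : Type*} [MeasurableSpace α] {μ : Measure α} {β : ι → Type*}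
    [∀ i, MeasurableSpace (β i)] {X : ∀ i, α → β i} (h : iIndepFun X μ) :
    iIndepFun (fun i (a : NullMeasurableSpace α μ) => X i a) μ.completion := by
  rw [iIndepFun_iff_measure_inter_preimage_eq_mul] at h ⊢
  intro S sets hS
  exact (Measure.completion_apply μ _).trans ((h S hS).trans
    (Finset.prod_congr rfl fun i _ => (Measure.completion_apply μ _).symm))

theorem exists_iIndepFun_fair_coins : ∃ μ : Measure (ℕ → Bool), IsProbabilityMeasure μ ∧
    iIndepFun (fun j (ω : ℕ → Bool) => ω j) μ ∧ ∀ j b, μ {ω | ω j = b} = 1 / 2 := by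
  have : IsProbabilityMeasure (uniformOn (Set.univ : Set Bool)) :=
    isProbabilityMeasure_uniformOn Set.finite_univ Set.univ_nonempty
  refine ⟨Measure.infinitePi fun _ => uniformOn Set.univ, inferInstance,
    iIndepFun_infinitePi (X := fun _ b => b) fun _ => measurable_id, fun j b => ?_⟩
  calc _ = uniformOn (Set.univ : Set Bool) {b} :=
        (measurePreserving_eval_infinitePi (fun _ : ℕ => uniformOn (Set.univ : Set Bool)) j
          ).measure_preimage (measurableSet_singleton b).nullMeasurableSet
    _ = 1 / 2 := by rw [uniformOn_univ]; simp

theorem exists_isRademacherFamily : ∃ (Ω : Type) (_ : MeasurableSpace Ω) (P : Measure Ω)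
    (r : ℕ → Ω → ℝ), IsRademacherFamily P r := by
  obtain ⟨μ, hμ, hindep, hfair⟩ := exists_iIndepFun_fair_coins
  let sign (b : Bool) : ℝ := if b then 1 else -1
  have hsign : Measurable sign := measurable_of_countable sign
  have hone (b : Bool) : sign b = 1 ↔ b = true := by cases b <;> norm_num [sign]
  have hneg_one (b : Bool) : sign b = -1 ↔ b = false := by cases b <;> norm_num [sign]
  refine ⟨NullMeasurableSpace (ℕ → Bool) μ, inferInstance, μ.completion, fun j ω => sign (ω j),
    { isProbabilityMeasure := ⟨(Measure.completion_apply μ _).trans measure_univ⟩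
      isComplete := inferInstance
      measurable := fun j s hs => ((hsign.comp (measurable_pi_apply j)) hs).nullMeasurableSet
      values := fun j ω => by cases ω j <;> simp [sign]
      prob_one := fun j => ?_
      prob_neg_one := fun j => ?_
      indep := iIndepFun_completion (hindep.comp (fun _ => sign) fun _ => hsign) }⟩
  · simp only [hone]
    exact (Measure.completion_apply μ _).trans (hfair j true)
  · simp only [hneg_one]
    exact (Measure.completion_apply μ _).trans (hfair j false)

end RademacherFamily

section Constants

variable {F : Type u} [NormedAddCommGroup F] [NormedSpace ℝ F] {n : ℕ}

theorem kahaneKhintchineConst_nonneg (q p : ℝ) : 0 ≤ kahaneKhintchineConst.{u} q p :=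
  Real.sInf_nonneg fun _ hK => hK.1.le

theorem rademacherNorm_le_kahaneKhintchineConst_mul [CompleteSpace F] {q p : ℝ} (hp : 1 ≤ p)
    (hq : 0 < q) (x : Fin n → F) :
    rademacherNorm q x ≤ kahaneKhintchineConst.{u} q p * rademacherNorm p x := by
  obtain ⟨Ω, _, P, r, hr⟩ := exists_isRademacherFamily
  have hbound (K : ℝ) (hK : IsKahaneKhintchineBound.{u} q p K) :
      rademacherNorm q x ≤ K * rademacherNorm p x := by
    simpa only [hr.lpNorm_sum x hq, hr.lpNorm_sum x (by linarith : 0 < p)] using hK.2 Ω P r hr F n x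
  exact le_sInf_mul (exists_isKahaneKhintchineBound q hp) (rademacherNorm_nonneg p x) hbound

theorem rademacherNorm_le_typeConst_mul {p : ℝ} (hF : HasRademacherType F p) (x : Fin n → F) :
    rademacherNorm p x ≤ typeConst F p * (∑ j, ‖x j‖ ^ p) ^ (1 / p) := by
  obtain ⟨Ω, _, P, r, hr⟩ := exists_isRademacherFamily
  have hp : 0 < p := by linarith [hF.1.1]
  have hbound (τ : ℝ) (hτ : IsTypeBound F p τ) :
      rademacherNorm p x ≤ τ * (∑ j, ‖x j‖ ^ p) ^ (1 / p) := by
    simpa only [hr.lpNorm_sum x hp] using hτ.2 Ω P r hr n x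
  exact le_sInf_mul hF.2 (by positivity) hbound

end Constants

/-! ### Evaluation functionals on tensor powers -/

/-- The continuous extension to the completion of `V` of a linear functional that is dominated by
the seminorm of `V`. -/
noncomputable def completionExtend {V : Type*} [SeminormedAddCommGroup V] [NormedSpace ℝ V]
    (l : V →ₗ[ℝ] ℝ) (hl : ∀ U, |l U| ≤ ‖U‖) : UniformSpace.Completion V →L[ℝ] ℝ :=
  (l.mkContinuous 1 fun U => (hl U).trans_eq (one_mul _).symm).extend
    UniformSpace.Completion.toComplL

section CompletionExtend

variable {V : Type*} [SeminormedAddCommGroup V] [NormedSpace ℝ V] (l : V →ₗ[ℝ] ℝ)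
  (hl : ∀ U, |l U| ≤ ‖U‖)

theorem completionExtend_coe (U : V) : completionExtend l hl U = l U :=
  ContinuousLinearMap.extend_eq _ UniformSpace.Completion.denseRange_coe
    (UniformSpace.Completion.isUniformInducing_coe _) U

theorem abs_completionExtend_le (z : UniformSpace.Completion V) :
    |completionExtend l hl z| ≤ ‖z‖ := by
  induction z using UniformSpace.Completion.induction_on with
  | hp => exact isClosed_le (by fun_prop) (by fun_prop)
  | ih U =>
    rw [completionExtend_coe, UniformSpace.Completion.norm_coe]
    exact hl U

end CompletionExtend

section Tensor

variable {k : ℕ} {E : Type u} [NormedAddCommGroup E] [NormedSpace ℝ E]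

variable (E) in
/-- The closed unit ball `B_{E'}` of the dual of `E`. -/
abbrev DualBall : Type u := Metric.closedBall (0 : StrongDual ℝ E) 1

instance : Nonempty (DualBall E) := ⟨⟨0, Metric.mem_closedBall_self zero_le_one⟩⟩

theorem DualBall.abs_apply_le (f : DualBall E) (x : E) : |f.1 x| ≤ ‖x‖ :=
  (f.1.le_opNorm x).trans (mul_le_of_le_one_left (norm_nonneg x) (mem_closedBall_zero_iff.mp f.2))

namespace AlgTensor

theorem abs_eval_le_norm (f : Fin k → DualBall E) (U : AlgTensor k E) :
    |AlgTensor.eval (fun n => (f n : StrongDual ℝ E)) U| ≤ ‖U‖ := by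
  obtain ⟨C, hC⟩ := AlgTensor.bddAbove U
  refine le_ciSup (f := fun f : DualBallTuple k E =>
    |AlgTensor.eval (fun n => (f n : StrongDual ℝ E)) U|) ⟨C, ?_⟩ f
  rintro _ ⟨g, rfl⟩
  exact hC _ fun n => mem_closedBall_zero_iff.mp (g n).2

theorem norm_pure_le (x : Fin k → E) : ‖AlgTensor.pure x‖ ≤ ∏ n, ‖x n‖ := by
  refine ciSup_le fun f => ?_
  rw [AlgTensor.eval_pure, Finset.abs_prod]
  exact Finset.prod_le_prod (fun _ _ => abs_nonneg _) fun n _ => DualBall.abs_apply_le (f n) (x n)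

theorem continuous_pure : Continuous (AlgTensor.pure : (Fin k → E) → AlgTensor k E) :=
  let tprod : MultilinearMap ℝ (fun _ : Fin k => E) (AlgTensor k E) := PiTensorProduct.tprod ℝ
  (tprod.mkContinuous 1 fun x => (norm_pure_le x).trans_eq (one_mul _).symm).cont

end AlgTensor

namespace SymAlgTensor

theorem abs_eval_le_norm (f : DualBall E) (U : SymAlgTensor k E) :
    |AlgTensor.eval (fun _ => f.1) (SymAlgTensor.incl k E U)| ≤ ‖U‖ := by
  obtain ⟨C, hC⟩ := AlgTensor.bddAbove (SymAlgTensor.incl k E U)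
  refine le_ciSup (f := fun f : DualBall E =>
    |AlgTensor.eval (fun _ => f.1) (SymAlgTensor.incl k E U)|) ⟨C, ?_⟩ f
  rintro _ ⟨g, rfl⟩
  exact hC _ fun _ => mem_closedBall_zero_iff.mp g.2

end SymAlgTensor

namespace InjTensor

/-- The extension of `f ⊗ ⋯ ⊗ f` to the full injective tensor product. -/
noncomputable def evalPow (f : DualBall E) : InjTensor k E →L[ℝ] ℝ :=
  completionExtend (AlgTensor.eval fun _ => f.1) (AlgTensor.abs_eval_le_norm fun _ => f)

theorem evalPow_tensorPow (f : DualBall E) (x : E) : evalPow f (tensorPow k x) = f.1 x ^ k := by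
  rw [evalPow, tensorPow, completionExtend_coe, AlgTensor.eval_pure, Finset.prod_const,
    Finset.card_fin]

theorem abs_evalPow_le_norm (f : DualBall E) (z : InjTensor k E) : |evalPow f z| ≤ ‖z‖ :=
  abs_completionExtend_le _ _ z

end InjTensor

namespace SymInjTensor

/-- The extension of `f ⊗ ⋯ ⊗ f` to the symmetric injective tensor product. -/
noncomputable def evalPow (f : DualBall E) : SymInjTensor k E →L[ℝ] ℝ :=
  completionExtend ((AlgTensor.eval fun _ => f.1) ∘ₗ SymAlgTensor.incl k E)
    (SymAlgTensor.abs_eval_le_norm f)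

theorem evalPow_coe (f : DualBall E) (U : SymAlgTensor k E) :
    evalPow f (U : SymInjTensor k E) = AlgTensor.eval (fun _ => f.1) (SymAlgTensor.incl k E U) :=
  completionExtend_coe _ _ U

theorem evalPow_symTensorPow (f : DualBall E) (x : E) :
    evalPow f (symTensorPow k x) = f.1 x ^ k :=
  (evalPow_coe f _).trans ((AlgTensor.eval_pure _ _).trans (by simp))

theorem abs_evalPow_le_norm (f : DualBall E) (z : SymInjTensor k E) : |evalPow f z| ≤ ‖z‖ :=
  abs_completionExtend_le _ _ z

theorem norm_le_of_forall_abs_evalPow_le {z : SymInjTensor k E} {C : ℝ}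
    (h : ∀ f : DualBall E, |evalPow f z| ≤ C) : ‖z‖ ≤ C := by
  refine le_of_forall_pos_le_add fun δ hδ => ?_
  obtain ⟨_, ⟨U, rfl⟩, hU⟩ := Metric.mem_closure_iff.mp
    (UniformSpace.Completion.denseRange_coe z) (δ / 2) (by positivity)
  rw [dist_eq_norm] at hU
  have hnorm : ‖(U : SymInjTensor k E)‖ ≤ C + δ / 2 := by
    rw [UniformSpace.Completion.norm_coe]
    refine ciSup_le fun f => ?_
    calc |AlgTensor.eval (fun _ => f.1) (SymAlgTensor.incl k E U)|
        = |evalPow f z - evalPow f (z - (U : SymInjTensor k E))| := by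
          rw [← map_sub, sub_sub_cancel, evalPow_coe]
      _ ≤ |evalPow f z| + |evalPow f (z - (U : SymInjTensor k E))| := abs_sub _ _
      _ ≤ C + δ / 2 := add_le_add (h f) ((abs_evalPow_le_norm f _).trans hU.le)
  calc ‖z‖ = ‖(U : SymInjTensor k E) + (z - U)‖ := by rw [add_sub_cancel]
    _ ≤ (C + δ / 2) + δ / 2 := (norm_add_le _ _).trans (add_le_add hnorm hU.le)
    _ = C + δ := by ring

theorem norm_eq_iSup_abs_evalPow (z : SymInjTensor k E) :
    ‖z‖ = ⨆ f : DualBall E, |evalPow f z| := by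
  have hbdd : BddAbove (Set.range fun f : DualBall E => |evalPow f z|) :=
    ⟨‖z‖, Set.forall_mem_range.mpr fun f => abs_evalPow_le_norm f z⟩
  exact le_antisymm (norm_le_of_forall_abs_evalPow_le fun f => le_ciSup hbdd f)
    (ciSup_le fun f => abs_evalPow_le_norm f z)

end SymInjTensor

theorem norm_sum_smul_symTensorPow {ι : Type*} (s : Finset ι) (c : ι → ℝ) (x : ι → E) :
    ‖∑ j ∈ s, c j • symTensorPow k (x j)‖ = ⨆ f : DualBall E, |∑ j ∈ s, c j * f.1 (x j) ^ k| := by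
  simp only [SymInjTensor.norm_eq_iSup_abs_evalPow, map_sum, map_smul,
    SymInjTensor.evalPow_symTensorPow, smul_eq_mul]

theorem norm_tensorPow_le (x : E) : ‖tensorPow k x‖ ≤ ‖x‖ ^ k := by
  rw [tensorPow, UniformSpace.Completion.norm_coe]
  simpa using AlgTensor.norm_pure_le fun _ : Fin k => x

theorem norm_symTensorPow_le (x : E) : ‖symTensorPow k x‖ ≤ ‖x‖ ^ k :=
  SymInjTensor.norm_le_of_forall_abs_evalPow_le fun f => by
    rw [SymInjTensor.evalPow_symTensorPow, abs_pow]
    gcongr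
    exact DualBall.abs_apply_le f x

theorem continuous_tensorPow : Continuous (tensorPow k : E → InjTensor k E) :=
  (UniformSpace.Completion.continuous_coe _).comp
    (AlgTensor.continuous_pure.comp (continuous_pi fun _ => continuous_id))

theorem norm_symTensorPow_sub_le (x y : E) :
    ‖symTensorPow k x - symTensorPow k y‖ ≤ ‖tensorPow k x - tensorPow k y‖ :=
  SymInjTensor.norm_le_of_forall_abs_evalPow_le fun f => by
    simpa only [map_sub, SymInjTensor.evalPow_symTensorPow, InjTensor.evalPow_tensorPow] using
      InjTensor.abs_evalPow_le_norm f (tensorPow k x - tensorPow k y)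

theorem continuous_symTensorPow : Continuous (symTensorPow k : E → SymInjTensor k E) := by
  refine continuous_iff_continuousAt.mpr fun x => tendsto_iff_norm_sub_tendsto_zero.mpr ?_
  exact squeeze_zero (fun _ => norm_nonneg _) (fun y => norm_symTensorPow_sub_le y x)
    (tendsto_iff_norm_sub_tendsto_zero.mp (continuous_tensorPow.tendsto x))

section Moments

variable {Ω : Type v} [MeasurableSpace Ω] {P : Measure Ω} {ξ : Ω → E}

theorem memLp_symTensorPow (hk : k ≠ 0) {q : ℝ} (hξ : MemLp ξ (ENNReal.ofReal (k * q)) P) :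
    MemLp (fun ω => symTensorPow k (ξ ω)) (ENNReal.ofReal q) P :=
  (memLp_norm_pow hk hξ).mono' (continuous_symTensorPow.comp_aestronglyMeasurable hξ.1)
    (Filter.Eventually.of_forall fun ω => norm_symTensorPow_le (ξ ω))

/- The functionals `f ⊗ ⋯ ⊗ f` separate the points of the symmetric tensor product and act in the
same way on the two kinds of powers. -/
theorem integral_symTensorPow_eq_zero (hξ : AEStronglyMeasurable ξ P)
    (hint : Integrable (fun ω => ‖ξ ω‖ ^ k) P) (hmoment : injMoment k P ξ = 0) :
    ∫ ω, symTensorPow k (ξ ω) ∂P = 0 := by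
  have htensor : Integrable (fun ω => tensorPow k (ξ ω)) P :=
    hint.mono' (continuous_tensorPow.comp_aestronglyMeasurable hξ)
      (Filter.Eventually.of_forall fun ω => norm_tensorPow_le (ξ ω))
  have hsymTensor : Integrable (fun ω => symTensorPow k (ξ ω)) P :=
    hint.mono' (continuous_symTensorPow.comp_aestronglyMeasurable hξ)
      (Filter.Eventually.of_forall fun ω => norm_symTensorPow_le (ξ ω))
  refine norm_le_zero_iff.mp (SymInjTensor.norm_le_of_forall_abs_evalPow_le fun f => ?_)
  refine (abs_eq_zero.mpr ?_).le
  calc SymInjTensor.evalPow f (∫ ω, symTensorPow k (ξ ω) ∂P) = ∫ ω, f.1 (ξ ω) ^ k ∂P := by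
        rw [← ContinuousLinearMap.integral_comp_comm _ hsymTensor]
        simp only [SymInjTensor.evalPow_symTensorPow]
    _ = InjTensor.evalPow f (injMoment k P ξ) := by
        rw [injMoment, ← ContinuousLinearMap.integral_comp_comm _ htensor]
        simp only [InjTensor.evalPow_tensorPow]
    _ = 0 := by rw [hmoment, map_zero]

end Moments

/-! ### Rademacher sums of symmetric tensor powers -/

theorem abs_pow_sub_pow_le_of_abs_le {a b c : ℝ} (ha : |a| ≤ c) (hb : |b| ≤ c) (k : ℕ) :
    |a ^ k - b ^ k| ≤ k * c ^ (k - 1) * |a - b| := by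
  calc |a ^ k - b ^ k| ≤ |a - b| * k * max |a| |b| ^ (k - 1) := abs_pow_sub_pow_le a b k
    _ ≤ |a - b| * k * c ^ (k - 1) := by gcongr; exact max_le ha hb
    _ = k * c ^ (k - 1) * |a - b| := by ring

theorem expect_norm_sum_symTensorPow_rpow_le (hk : k ≠ 0) {p : ℝ} (hp : 1 ≤ p) {n : ℕ}
    (x : Fin n → E) :
    𝔼 ε ∈ signVectors n, ‖∑ j, ε j • symTensorPow k (x j)‖ ^ p ≤
      2 * 𝔼 ε ∈ signVectors n, ‖∑ j, ε j • ((k * ‖x j‖ ^ (k - 1)) • x j)‖ ^ p := by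
  set y : Fin n → E := fun j => (k * ‖x j‖ ^ (k - 1)) • x j with hy
  have hy_apply (f : DualBall E) (j : Fin n) : f.1 (y j) = k * ‖x j‖ ^ (k - 1) * f.1 (x j) := by
    rw [hy, map_smul, smul_eq_mul]
  have hlip (j : Fin n) (f g : DualBall E) :
      |f.1 (x j) ^ k - g.1 (x j) ^ k| ≤ |f.1 (y j) - g.1 (y j)| := by
    rw [hy_apply, hy_apply, ← mul_sub, abs_mul,
      abs_of_nonneg (by positivity : 0 ≤ k * ‖x j‖ ^ (k - 1))]
    exact abs_pow_sub_pow_le_of_abs_le (f.abs_apply_le _) (g.abs_apply_le _) k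
  have hlip_zero (j : Fin n) (f : DualBall E) : |f.1 (x j) ^ k| ≤ |f.1 (y j)| := by
    simpa [zero_pow hk] using hlip j f ⟨0, Metric.mem_closedBall_self zero_le_one⟩
  obtain ⟨D, hD⟩ := Finite.exists_le fun j => ‖y j‖
  have hcontraction := expect_iSup_abs_rpow_contraction hp
    (fun j (f : DualBall E) => (f.abs_apply_le (y j)).trans (hD j)) hlip_zero hlip
  simp only [norm_sum_smul_symTensorPow]
  refine hcontraction.trans ?_
  gcongr with ε
  · exact Real.iSup_nonneg fun _ => abs_nonneg _
  · refine ciSup_le fun f => ?_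
    simpa only [map_sum, map_smul, smul_eq_mul] using f.abs_apply_le (∑ j, ε j • y j)

theorem rademacherNorm_symTensorPow_le_two_mul (hk : k ≠ 0) {p : ℝ} (hp : 1 ≤ p) {n : ℕ}
    (x : Fin n → E) : rademacherNorm p (fun j => symTensorPow k (x j)) ≤
      2 * rademacherNorm p fun j => (k * ‖x j‖ ^ (k - 1)) • x j := by
  have htwo : (2 : ℝ) ^ (1 / p) ≤ 2 :=
    Real.rpow_le_self_of_one_le one_le_two (by rw [div_le_one (by positivity)]; exact hp)
  simp only [rademacherNorm]
  have hnonneg : 0 ≤ 𝔼 ε ∈ signVectors n, ‖∑ j, ε j • ((k * ‖x j‖ ^ (k - 1)) • x j)‖ ^ p :=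
    Finset.expect_nonneg fun _ _ => by positivity
  calc _ ≤ (2 * 𝔼 ε ∈ signVectors n,
          ‖∑ j, ε j • ((k * ‖x j‖ ^ (k - 1)) • x j)‖ ^ p) ^ (1 / p) := by
        gcongr
        exact expect_norm_sum_symTensorPow_rpow_le hk hp x
    _ ≤ _ := by
        rw [Real.mul_rpow two_pos.le hnonneg]
        gcongr

theorem rademacherNorm_symTensorPow_le (hk : k ≠ 0) {p q : ℝ} (hp : HasRademacherType E p)
    (hq : 0 < q) {n : ℕ} (x : Fin n → E) :
    rademacherNorm q (fun j => symTensorPow k (x j)) ≤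
      2 * k * kahaneKhintchineConst.{u} q p * typeConst E p *
        (∑ j, (‖x j‖ ^ k) ^ p) ^ (1 / p) := by
  have hp0 : 0 < p := by linarith [hp.1.1]
  have hnorm (j : Fin n) : ‖((k : ℝ) * ‖x j‖ ^ (k - 1)) • x j‖ = k * ‖x j‖ ^ k := by
    rw [norm_smul, Real.norm_of_nonneg (by positivity), mul_assoc, pow_sub_one_mul hk]
  have htype : (∑ j, ‖((k : ℝ) * ‖x j‖ ^ (k - 1)) • x j‖ ^ p) ^ (1 / p) =
      k * (∑ j, (‖x j‖ ^ k) ^ p) ^ (1 / p) := by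
    have hrpow (j : Fin n) : (k * ‖x j‖ ^ k) ^ p = (k : ℝ) ^ p * (‖x j‖ ^ k) ^ p :=
      Real.mul_rpow (by positivity) (by positivity)
    simp only [hnorm, hrpow, ← Finset.mul_sum]
    rw [Real.mul_rpow (by positivity) (by positivity), one_div,
      Real.rpow_rpow_inv (Nat.cast_nonneg k) hp0.ne']
  have hK := kahaneKhintchineConst_nonneg.{u} q p
  calc rademacherNorm q (fun j => symTensorPow k (x j))
      ≤ kahaneKhintchineConst.{u} q p * rademacherNorm p fun j => symTensorPow k (x j) :=
        rademacherNorm_le_kahaneKhintchineConst_mul hp.1.1 hq _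
    _ ≤ kahaneKhintchineConst.{u} q p *
          (2 * (typeConst E p * (k * (∑ j, (‖x j‖ ^ k) ^ p) ^ (1 / p)))) := by
        grw [rademacherNorm_symTensorPow_le_two_mul hk hp.1.1, rademacherNorm_le_typeConst_mul hp,
          htype]
    _ = _ := by ring

end Tensor

/-! ### Symmetrization -/

section Symmetrization

variable {Ω : Type v} {F : Type*} [NormedAddCommGroup F] [NormedSpace ℝ F]

theorem sum_smul_eq_sum_sub_sum {n : ℕ} {ε : Fin n → ℝ} (hε : ε ∈ signVectors n) (y : Fin n → F) :
    ∑ j, ε j • y j = ∑ j with ε j = 1, y j - ∑ j with ε j ≠ 1, y j := by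
  rw [← Finset.sum_filter_add_sum_filter_not _ (fun j => ε j = 1), sub_eq_add_neg,
    ← Finset.sum_neg_distrib]
  refine congrArg₂ _ (Finset.sum_congr rfl fun j hj => ?_) (Finset.sum_congr rfl fun j hj => ?_)
  · rw [(Finset.mem_filter.mp hj).2, one_smul]
  · rw [(mem_signVectors.mp hε j).resolve_left (Finset.mem_filter.mp hj).2, neg_one_smul]

section RademacherNorm

variable [MeasurableSpace Ω] {P : Measure Ω}

theorem aestronglyMeasurable_rademacherNorm {n : ℕ} {Y : Fin n → Ω → F} {q : ℝ} (hq : 0 ≤ q)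
    (hY : ∀ j, AEStronglyMeasurable (Y j) P) :
    AEStronglyMeasurable (fun ω => rademacherNorm q fun j => Y j ω) P := by
  simp only [rademacherNorm, Finset.expect_eq_sum_div_card]
  have hsum (ε : Fin n → ℝ) : AEStronglyMeasurable (fun ω => ‖∑ j, ε j • Y j ω‖ ^ q) P :=
    (Real.continuous_rpow_const hq).comp_aestronglyMeasurable
      (Finset.aestronglyMeasurable_fun_sum _ fun j _ => (hY j).const_smul (ε j)).norm
  exact (Real.continuous_rpow_const (by positivity)).comp_aestronglyMeasurable
    ((continuous_id.div_const _).comp_aestronglyMeasurable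
      (Finset.aestronglyMeasurable_fun_sum _ fun ε _ => hsum ε))

theorem lpNorm_rademacherNorm_rpow {n : ℕ} {Y : Fin n → Ω → F} {q : ℝ} (hq : 0 < q)
    (hY : ∀ j, MemLp (Y j) (ENNReal.ofReal q) P) :
    lpNorm (fun ω => rademacherNorm q fun j => Y j ω) (ENNReal.ofReal q) P ^ q =
      𝔼 ε ∈ signVectors n, lpNorm (∑ j, ε j • Y j) (ENNReal.ofReal q) P ^ q := by
  have hsum (ε : Fin n → ℝ) : MemLp (∑ j, ε j • Y j) (ENNReal.ofReal q) P :=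
    memLp_finsetSum' _ fun j _ => (hY j).const_smul (ε j)
  have hint (ε : Fin n → ℝ) : Integrable (fun ω => ‖∑ j, ε j • Y j ω‖ ^ q) P := by
    simpa [ENNReal.toReal_ofReal hq.le] using
      (hsum ε).integrable_norm_rpow (by simpa using hq) ENNReal.ofReal_ne_top
  calc lpNorm (fun ω => rademacherNorm q fun j => Y j ω) (ENNReal.ofReal q) P ^ q
      = ∫ ω, 𝔼 ε ∈ signVectors n, ‖∑ j, ε j • Y j ω‖ ^ q ∂P := by
        rw [lpNorm_ofReal_rpow hq (aestronglyMeasurable_rademacherNorm hq.le fun j => (hY j).1)]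
        refine integral_congr_ae (Filter.Eventually.of_forall fun ω => ?_)
        dsimp only
        rw [Real.norm_of_nonneg (rademacherNorm_nonneg _ _), rademacherNorm, one_div]
        exact Real.rpow_inv_rpow (Finset.expect_nonneg fun _ _ => by positivity) hq.ne'
    _ = 𝔼 ε ∈ signVectors n, ∫ ω, ‖∑ j, ε j • Y j ω‖ ^ q ∂P := by
        simp only [Finset.expect_eq_sum_div_card]
        rw [integral_div, integral_finsetSum _ fun ε _ => hint ε]
    _ = 𝔼 ε ∈ signVectors n, lpNorm (∑ j, ε j • Y j) (ENNReal.ofReal q) P ^ q := by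
        simp only [lpNorm_ofReal_rpow hq (hsum _).1, Finset.sum_apply, Pi.smul_apply]

end RademacherNorm

variable [CompleteSpace F]

/- `X` is the conditional expectation of `X + Z`, and conditional expectation is a contraction. -/
theorem lpNorm_le_lpNorm_add_of_indep {m₁ m₂ m : MeasurableSpace Ω} {P : Measure[m] Ω}
    [IsProbabilityMeasure P] (h₁ : m₁ ≤ m) (h₂ : m₂ ≤ m) (hindep : Indep m₁ m₂ P) {X Z : Ω → F}
    (hX : StronglyMeasurable[m₁] X) (hZ : StronglyMeasurable[m₂] Z) {q : ℝ≥0∞} (hq : 1 ≤ q)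
    (hXq : MemLp X q P) (hZq : MemLp Z q P) (hZ0 : ∫ ω, Z ω ∂P = 0) :
    lpNorm X q P ≤ lpNorm (X + Z) q P := by
  have hcondExp : P[X + Z | m₁] =ᵐ[P] X := by
    filter_upwards [condExp_add (hXq.integrable hq) (hZq.integrable hq) m₁,
      condExp_indep_eq h₂ h₁ hZ hindep.symm] with ω hadd hcentred
    rw [hadd, Pi.add_apply, hcentred, hZ0, add_zero,
      condExp_of_stronglyMeasurable h₁ hX (hXq.integrable hq)]
  rw [← lpNorm_congr_ae hcondExp]
  exact (hXq.add hZq).lpNorm_condExp_le_lpNorm hq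

variable [MeasurableSpace Ω] {P : Measure Ω} [MeasurableSpace F] [BorelSpace F]

theorem lpNorm_sum_le_lpNorm_sum_sub_sum [IsProbabilityMeasure P] {ι : Type*} {Y : ι → Ω → F}
    (hindep : iIndepFun Y P) {q : ℝ≥0∞} (hq : 1 ≤ q) (hY : ∀ j, MemLp (Y j) q P)
    (hY0 : ∀ j, ∫ ω, Y j ω ∂P = 0) {S T : Finset ι} (hST : Disjoint S T) :
    lpNorm (∑ j ∈ S, Y j) q P ≤ lpNorm (∑ j ∈ S, Y j - ∑ j ∈ T, Y j) q P := by
  have hsum (S : Finset ι) : MemLp (∑ j ∈ S, Y j) q P := memLp_finsetSum' _ fun j _ => hY j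
  set Y' : ι → Ω → F := fun j => (hY j).1.mk (Y j) with hY'
  have hY'_meas (j : ι) : StronglyMeasurable (Y' j) := (hY j).1.stronglyMeasurable_mk
  have hsum_ae (S : Finset ι) : ∑ j ∈ S, Y j =ᵐ[P] ∑ j ∈ S, Y' j := by
    filter_upwards [(Filter.eventually_all_finset S).mpr fun j _ => (hY j).1.ae_eq_mk] with ω hω
    simp only [Finset.sum_apply, hY', Finset.sum_congr rfl hω]
  let m (j : ι) : MeasurableSpace Ω := MeasurableSpace.comap (Y' j) inferInstance
  have hm (j : ι) : m j ≤ _ := (hY'_meas j).measurable.comap_le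
  have hindep' : iIndep m P :=
    (iIndepFun_iff_iIndep _ _ _).mp (hindep.congr fun j => (hY j).1.ae_eq_mk)
  have hsum_meas (S : Finset ι) : StronglyMeasurable[⨆ j ∈ (S : Set ι), m j] (∑ j ∈ S, Y' j) :=
    Finset.stronglyMeasurable_sum S fun j hj =>
      (stronglyMeasurable_iff_measurable_separable.mpr
        ⟨comap_measurable (Y' j), (hY'_meas j).isSeparable_range⟩).mono
      (le_iSup₂_of_le (f := fun j (_ : j ∈ (S : Set ι)) => m j) j hj le_rfl)
  have hT0 : ∫ ω, (-∑ j ∈ T, Y' j) ω ∂P = 0 := by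
    rw [← integral_congr_ae (hsum_ae T).neg]
    simp only [Pi.neg_apply, Finset.sum_apply]
    rw [integral_neg, integral_finsetSum _ fun j _ => (hY j).integrable hq,
      Finset.sum_eq_zero fun j _ => hY0 j, neg_zero]
  rw [lpNorm_congr_ae (hsum_ae S), lpNorm_congr_ae ((hsum_ae S).sub (hsum_ae T)), sub_eq_add_neg]
  exact lpNorm_le_lpNorm_add_of_indep (iSup₂_le fun j _ => hm j) (iSup₂_le fun j _ => hm j)
    (indep_iSup_of_disjoint hm hindep' (Finset.disjoint_coe.mpr hST)) (hsum_meas S)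
    (hsum_meas T).neg hq ((hsum S).ae_eq (hsum_ae S)) ((hsum T).ae_eq (hsum_ae T)).neg hT0

theorem lpNorm_sum_le_two_mul_lpNorm_sum_smul [IsProbabilityMeasure P] {n : ℕ} {Y : Fin n → Ω → F}
    (hindep : iIndepFun Y P) {q : ℝ≥0∞} (hq : 1 ≤ q) (hY : ∀ j, MemLp (Y j) q P)
    (hY0 : ∀ j, ∫ ω, Y j ω ∂P = 0) {ε : Fin n → ℝ} (hε : ε ∈ signVectors n) :
    lpNorm (∑ j, Y j) q P ≤ 2 * lpNorm (∑ j, ε j • Y j) q P := by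
  let S : Finset (Fin n) := {j | ε j = 1}
  let T : Finset (Fin n) := {j | ε j ≠ 1}
  have hST : Disjoint S T := Finset.disjoint_filter_filter_not _ _ _
  have hsplit : ∑ j, Y j = ∑ j ∈ S, Y j + ∑ j ∈ T, Y j :=
    (Finset.sum_filter_add_sum_filter_not _ _ _).symm
  have hsigned : ∑ j, ε j • Y j = ∑ j ∈ S, Y j - ∑ j ∈ T, Y j := by
    ext ω
    simpa using sum_smul_eq_sum_sub_sum hε fun j => Y j ω
  calc lpNorm (∑ j, Y j) q P ≤ lpNorm (∑ j ∈ S, Y j) q P + lpNorm (∑ j ∈ T, Y j) q P := by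
        rw [hsplit]
        exact lpNorm_add_le (memLp_finsetSum' _ fun j _ => hY j) hq
    _ ≤ lpNorm (∑ j ∈ S, Y j - ∑ j ∈ T, Y j) q P + lpNorm (∑ j ∈ T, Y j - ∑ j ∈ S, Y j) q P :=
        add_le_add (lpNorm_sum_le_lpNorm_sum_sub_sum hindep hq hY hY0 hST)
          (lpNorm_sum_le_lpNorm_sum_sub_sum hindep hq hY hY0 hST.symm)
    _ = 2 * lpNorm (∑ j, ε j • Y j) q P := by
        rw [lpNorm_sub_comm (∑ j ∈ T, Y j), hsigned, two_mul]

theorem lpNorm_sum_le_two_mul_lpNorm_rademacherNorm [IsProbabilityMeasure P] {n : ℕ}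
    {Y : Fin n → Ω → F} (hindep : iIndepFun Y P) {q : ℝ} (hq : 1 ≤ q)
    (hY : ∀ j, MemLp (Y j) (ENNReal.ofReal q) P) (hY0 : ∀ j, ∫ ω, Y j ω ∂P = 0) :
    lpNorm (∑ j, Y j) (ENNReal.ofReal q) P ≤
      2 * lpNorm (fun ω => rademacherNorm q fun j => Y j ω) (ENNReal.ofReal q) P := by
  have hq0 : 0 < q := by linarith
  rw [← Real.rpow_le_rpow_iff lpNorm_nonneg (mul_nonneg two_pos.le lpNorm_nonneg) hq0,
    Real.mul_rpow two_pos.le lpNorm_nonneg, lpNorm_rademacherNorm_rpow hq0 hY, Finset.mul_expect,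
    ← Finset.expect_const (signVectors_nonempty n)
      (lpNorm (∑ j, Y j) (ENNReal.ofReal q) P ^ q)]
  refine Finset.expect_le_expect fun ε hε => ?_
  rw [← Real.mul_rpow two_pos.le lpNorm_nonneg]
  exact Real.rpow_le_rpow lpNorm_nonneg (lpNorm_sum_le_two_mul_lpNorm_sum_smul hindep
    (by simpa using hq) hY hY0 hε) hq0.le

end Symmetrization

/-! ### The moment inequality -/

theorem typeConst_nonneg (F : Type u) [NormedAddCommGroup F] [NormedSpace ℝ F] (p : ℝ) :
    0 ≤ typeConst F p :=
  Real.sInf_nonneg fun _ hτ => hτ.1.le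

theorem lpNorm_rademacherNorm_symTensorPow_le {E : Type u} [NormedAddCommGroup E] [NormedSpace ℝ E]
    {Ω : Type v} [MeasurableSpace Ω] {P : Measure Ω} {p q : ℝ} (hp : HasRademacherType E p)
    (hpq : p ≤ q) {k M : ℕ} (hk : k ≠ 0) {η : Fin M → Ω → E}
    (hη : ∀ j, MemLp (η j) (ENNReal.ofReal (k * q)) P) :
    lpNorm (fun ω => rademacherNorm q fun j => symTensorPow k (η j ω)) (ENNReal.ofReal q) P ≤
      2 * k * kahaneKhintchineConst.{u} q p * typeConst E p *
        (∑ j, lpNorm (η j) (ENNReal.ofReal (k * q)) P ^ (k * p)) ^ (1 / p) := by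
  have hp0 : 0 < p := by linarith [hp.1.1]
  have hK := kahaneKhintchineConst_nonneg.{u} q p
  have hτ := typeConst_nonneg E p
  obtain ⟨hmem, hMinkowski⟩ := lpNorm_rpow_sum_rpow_le Finset.univ hp0 hpq
    fun j _ => memLp_norm_pow hk (hη j)
  simp only [norm_pow, norm_norm] at hmem hMinkowski
  calc lpNorm (fun ω => rademacherNorm q fun j => symTensorPow k (η j ω)) (ENNReal.ofReal q) P
      ≤ lpNorm (fun ω => 2 * k * kahaneKhintchineConst.{u} q p * typeConst E p *
          (∑ j, (‖η j ω‖ ^ k) ^ p) ^ (1 / p)) (ENNReal.ofReal q) P :=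
        lpNorm_mono_real (hmem.const_mul _) fun ω => by
          rw [Real.norm_of_nonneg (rademacherNorm_nonneg _ _)]
          exact rademacherNorm_symTensorPow_le hk hp (by linarith) fun j => η j ω
    _ = 2 * k * kahaneKhintchineConst.{u} q p * typeConst E p *
          lpNorm (fun ω => (∑ j, (‖η j ω‖ ^ k) ^ p) ^ (1 / p)) (ENNReal.ofReal q) P :=
        (lpNorm_const_smul (_ : ℝ) _ P).trans
          (by rw [coe_nnnorm, Real.norm_of_nonneg (by positivity)])
    _ ≤ 2 * k * kahaneKhintchineConst.{u} q p * typeConst E p *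
          (∑ j, lpNorm (fun ω => ‖η j ω‖ ^ k) (ENNReal.ofReal q) P ^ p) ^ (1 / p) := by
        gcongr
    _ = _ := by
        simp only [lpNorm_norm_pow hk (hη _).1, Real.rpow_natCast_mul lpNorm_nonneg]

end InjectiveMoments

open InjectiveMoments in
theorem mainTheorem11_general {E : Type u} [NormedAddCommGroup E] [NormedSpace ℝ E]
    [MeasurableSpace E] [BorelSpace E]
    {Ω : Type v} [MeasurableSpace Ω] (P : Measure Ω) [IsProbabilityMeasure P]
    (p q : ℝ) (hp : HasRademacherType E p) (hpq : p ≤ q)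
    (k M : ℕ) (hk : 1 ≤ k) (η : Fin M → Ω → E)
    (hη : ∀ j, MemLp (η j) (ENNReal.ofReal (k * q)) P)
    (hindep : iIndepFun η P)
    (hmoment : ∀ j, injMoment k P (η j) = 0) :
    MemLp (fun ω => ∑ j, symTensorPow k (η j ω)) (ENNReal.ofReal q) P ∧
    lpNorm (fun ω => ∑ j, symTensorPow k (η j ω)) (ENNReal.ofReal q) P ≤
      4 * k * kahaneKhintchineConst.{u} q p * typeConst E p *
        (∑ j, lpNorm (η j) (ENNReal.ofReal (k * q)) P ^ (k * p)) ^ (1 / p) := by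
  have hk0 : k ≠ 0 := by lia
  have hq : 1 ≤ q := hp.1.1.trans hpq
  borelize (SymInjTensor k E)
  have hpow (j : Fin M) := memLp_symTensorPow hk0 (hη j)
  have hcentred (j : Fin M) : ∫ ω, symTensorPow k (η j ω) ∂P = 0 :=
    integral_symTensorPow_eq_zero (hη j).1
      ((memLp_norm_pow hk0 (hη j)).integrable (by simpa using hq)) (hmoment j)
  have hsymm := lpNorm_sum_le_two_mul_lpNorm_rademacherNorm
    (hindep.comp _ fun _ => continuous_symTensorPow.measurable) hq hpow hcentred
  refine ⟨memLp_finsetSum _ fun j _ => hpow j, ?_⟩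
  calc lpNorm (fun ω => ∑ j, symTensorPow k (η j ω)) (ENNReal.ofReal q) P
      ≤ 2 * lpNorm (fun ω => rademacherNorm q fun j => symTensorPow k (η j ω))
          (ENNReal.ofReal q) P := by simpa only [Finset.sum_fn, Function.comp_apply] using hsymm
    _ ≤ 2 * (2 * k * kahaneKhintchineConst.{u} q p * typeConst E p *
          (∑ j, lpNorm (η j) (ENNReal.ofReal (k * q)) P ^ (k * p)) ^ (1 / p)) := by
        gcongr
        exact lpNorm_rademacherNorm_symTensorPow_le hp hpq hk0 hη
    _ = _ := by ring

theorem mainTheorem11 {E : Type u} [NormedAddCommGroup E] [NormedSpace ℝ E] [CompleteSpace E]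
    [MeasurableSpace E] [BorelSpace E]
    {Ω : Type v} [MeasurableSpace Ω] (P : Measure Ω) [IsProbabilityMeasure P]
    (p q : ℝ) (hp : InjectiveMoments.HasRademacherType E p) (hpq : p ≤ q)
    (k M : ℕ) (hk : 1 ≤ k) (η : Fin M → Ω → E)
    (hη : ∀ j, MemLp (η j) (ENNReal.ofReal (k * q)) P)
    (hindep : iIndepFun η P)
    (hmoment : ∀ j, InjectiveMoments.injMoment k P (η j) = 0) :
    MemLp (fun ω => ∑ j, InjectiveMoments.symTensorPow k (η j ω)) (ENNReal.ofReal q) P ∧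
    lpNorm (fun ω => ∑ j, InjectiveMoments.symTensorPow k (η j ω)) (ENNReal.ofReal q) P ≤
      4 * k * InjectiveMoments.kahaneKhintchineConst.{u} q p * InjectiveMoments.typeConst E p *
        (∑ j, lpNorm (η j) (ENNReal.ofReal (k * q)) P ^ (k * p)) ^ (1 / p) :=
  mainTheorem11_general P p q hp hpq k M hk η hη hindep hmoment
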